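/- **Proposition 5.1 (Stay-away estimate with splitting).** Let $n\ge 2$ and let $\Omega\subset\mathbb R^{n+1}$ be a compact convex set with $0$ in its interior, with $C^1$ boundary and $\Omega\subset B_R(0)$ (the open ball). Write $\mathcal N_\Omega(X)$ for the outward unit normal at $X\in\partial\Omega$, $\partial\Omega^+(X_0):=\{X\in\partial\Omega:\langle\mathcal N_\Omega(X),\mathcal N_\Omega(X_0)\rangle>0\}$, $\mathrm{proj}^\Omega_{X_0}$ for the orthogonal projection of vectors onto the tangent hyperplane $\mathcal N_\Omega(X_0)^\perp$, and $$\omega_\Omega(r):=\sup\{|\mathcal N_\Omega(X_1)-\mathcal N_\Omega(X_2)| : X_1,X_2\in\partial\Omega,\ |X_1-X_2|<r\}.$$ Let $c(X,\bar X):=\tfrac12|X-\bar X|^2$. For $v:B_R(0)\to\mathbb R\cup\{\infty\}$ let $v^c(\bar X):=\sup_{X\in B_R(0)}(-c(X,\bar X)-v(X))$; a function $u: B_R(0)\to\mathbb R\cup\{\infty\}$ is $c$-convex if $u=v^c\not\equiv\infty$ for some such $v$. For $u$ $c$-convex and $X\in\partial\Omega$ let $$\partial_c^\Omega u(X):=\{\bar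 X\in\partial\Omega: u(Y)\ge -c(Y,\bar X)+c(X,\bar X)+u(X)\ \ \forall\, Y\in\partial\Omega\}.$$ Let $\mu=\rho\,d\mathcal H^n$ and $\bar\mu$ be probability measures on $\partial\Omega$, let $0<\rho_0\le\operatorname{ess\,inf}_{\partial\Omega}\rho$, and let $$W_2(\mu,\bar\mu):=\Big(\inf_\gamma\int_{\partial\Omega\times\partial\Omega} c\,d\gamma\Big)^{1/2},$$ where $\gamma$ ranges over the probability measures with marginals $\mu$ and $\bar\mu$. Let $(u,u^c)$ be a maximizing pair in the dual problem, that is, $u$ is $c$-convex and maximizes $-\int_{\partial\Omega} w\,d\mu-\int_{\partial\Omega} w^c\,d\bar\mu$ among all $c$-convex $w$. Let $\Theta\in[\tfrac12,1)$ and let $r_\Omega(\Theta)>0$ be any number with $\omega_\Omega(r_\Omega(\Theta))<\sqrt{2-2\Theta}$. Then for every $X_0\in\partial\Omega$ and every $\bar X_0\in\partial^\Omega_c u(X_0)\cap\partial\Omega^+(X_0)$, $$\big|\mathrm{proj}^\Omega_{X_0}(X_0-\bar X_0)\big|\le C_{\rho_0,\Omega}\,W_2(\mu,\bar\mu)^{\frac{2}{n+2}},$$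 where $$C_{\rho_0,\Omega}:=\left(\frac{2^{n-2}\rho_0\,\mathcal H^{n-2}(\mathbb S^{n-2})}{n(n+1)}\,\min\!\Big(\tfrac{r_\Omega(\Theta)^2}{48\,\mathrm{diam}(\Omega)^2+2r_\Omega(\Theta)^2},\tfrac{r_\Omega(\Theta)}{8\,\mathrm{diam}(\Omega)},\tfrac1{16}\Big)^{n}\int_0^{\pi/2}\cos^{n+2}\phi\,\sin^{n-2}\phi\,d\phi\right)^{-\frac1{n+2}}.$$ In particular the constant depends only on $n$, $\rho_0$, $\mathrm{diam}(\Omega)$ and the modulus of continuity of the normal (through $r_\Omega(\Theta)$). -/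

import Mathlib

open Set Metric MeasureTheory
open scoped ENNReal RealInnerProductSpace

noncomputable section

namespace StayAway

section Geometry

variable {E : Type*} [NormedAddCommGroup E] [InnerProductSpace ℝ E]

/-- `Ω` is a convex body: a compact convex set containing the origin in its interior. -/
structure IsConvexBody (Ω : Set E) : Prop where
  isCompact : IsCompact Ω
  convex : Convex ℝ Ω
  zero_mem_interior : (0 : E) ∈ interior Ω

/-- `Ω` has `C¹` boundary: near each boundary point, `Ω` is the sublevel set `{f ≤ 0}` of a `C¹`
function `f` whose derivative does not vanish at that point. -/
def HasC1Boundary (Ω : Set E) : Prop :=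
  ∀ X ∈ frontier Ω, ∃ U : Set E, IsOpen U ∧ X ∈ U ∧ ∃ f : E → ℝ,
    ContDiffOn ℝ 1 f U ∧ fderiv ℝ f X ≠ 0 ∧ Ω ∩ U = {Y | Y ∈ U ∧ f Y ≤ 0}

/-- The set of outward unit normal vectors to `Ω` at `X`. -/
def outwardNormals (Ω : Set E) (X : E) : Set E :=
  {V | ‖V‖ = 1 ∧ ∀ Y ∈ Ω, ⟪V, Y - X⟫ ≤ 0}

/-- The outward unit normal to `Ω` at `X ∈ ∂Ω`. It is meaningful where there is exactly one, as is
the case at every boundary point of a convex body with `C¹` boundary. -/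
def normal (Ω : Set E) (X : E) : E :=
  Classical.epsilon fun V => V ∈ outwardNormals Ω X

/-- The modulus of continuity of the outward unit normal along `∂Ω`. -/
def normalModulus (Ω : Set E) (r : ℝ) : ℝ :=
  sSup {t | ∃ X₁ ∈ frontier Ω, ∃ X₂ ∈ frontier Ω,
    ‖X₁ - X₂‖ < r ∧ t = ‖normal Ω X₁ - normal Ω X₂‖}

/-- The points of `∂Ω` on the same side as `X₀`: those whose outward normal has positive inner
product with the outward normal at `X₀`. -/
def sameSide (Ω : Set E) (X₀ : E) : Set E :=
  {X | X ∈ frontier Ω ∧ 0 < ⟪normal Ω X, normal Ω X₀⟫}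

/-- Orthogonal projection of vectors onto the (linear) tangent hyperplane of `∂Ω` at `X`. -/
def tangentProj (Ω : Set E) (X : E) (V : E) : E :=
  (ℝ ∙ normal Ω X)ᗮ.starProjection V

end Geometry

section Transport

variable {E : Type*} [NormedAddCommGroup E]

/-- The quadratic cost. -/
def cost (X Y : E) : ℝ := ‖X - Y‖ ^ 2 / 2

/-- The `c`-transform over the open ball of radius `R` about the origin. Only the values of `u` on
that ball matter. -/
def cTransform (R : ℝ) (u : E → EReal) (Y : E) : EReal :=
  ⨆ X ∈ ball (0 : E) R, (((-cost X Y : ℝ) : EReal) - u X)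

/-- `u` takes values in `ℝ ∪ {∞}` on the open ball of radius `R`. -/
def NeBotOnBall (R : ℝ) (u : E → EReal) : Prop :=
  ∀ X ∈ ball (0 : E) R, u X ≠ ⊥

/-- `u : B_R(0) → ℝ ∪ {∞}` is `c`-convex: it is the `c`-transform of some
`v : B_R(0) → ℝ ∪ {∞}` and is not identically `∞`. (Values off the ball are irrelevant.) -/
def IsCConvex (R : ℝ) (u : E → EReal) : Prop :=
  NeBotOnBall R u ∧ (∃ X ∈ ball (0 : E) R, u X ≠ ⊤) ∧
    ∃ v : E → EReal, NeBotOnBall R v ∧ ∀ X ∈ ball (0 : E) R, u X = cTransform R v X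

/-- The `c`-subdifferential of `u` at `X` with respect to `Ω`. -/
def cSubdiff (Ω : Set E) (u : E → EReal) (X : E) : Set E :=
  {Xb | Xb ∈ frontier Ω ∧
    ∀ Y ∈ frontier Ω, ((-cost Y Xb + cost X Xb : ℝ) : EReal) + u X ≤ u Y}

variable [MeasurableSpace E]

/-- Probability measures on the product with marginals `μ` and `ν`. -/
def couplings (μ ν : Measure E) : Set (Measure (E × E)) :=
  {γ | IsProbabilityMeasure γ ∧ γ.map Prod.fst = μ ∧ γ.map Prod.snd = ν}

/-- The 2-Monge-Kantorovich distance: the square root of the optimal transport cost for `cost`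
(which includes the factor `1/2`). -/
def W₂ (μ ν : Measure E) : ℝ :=
  Real.sqrt (⨅ γ ∈ couplings μ ν, ∫⁻ p, ENNReal.ofReal (cost p.1 p.2) ∂γ).toReal

/-- The dual functional `-∫ u dμ - ∫ u^c dν`. (A `c`-convex `u` and its transform `u^c` are finite
and Lipschitz on the ball, so for finite measures carried by a compact subset of the ball these are
integrals of bounded functions.) -/
def dualValue (R : ℝ) (μ ν : Measure E) (u : E → EReal) : ℝ :=
  -(∫ X, (u X).toReal ∂μ) - ∫ Y, (cTransform R u Y).toReal ∂ν

/-- `(u, u^c)` is a maximizing pair in the dual problem: `u` is `c`-convex and maximizes the dual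
functional among all `c`-convex functions. -/
def IsDualMaximizer (R : ℝ) (μ ν : Measure E) (u : E → EReal) : Prop :=
  IsCConvex R u ∧ ∀ w : E → EReal, IsCConvex R w → dualValue R μ ν w ≤ dualValue R μ ν u

end Transport

/-- The `n`-dimensional Hausdorff measure, normalized to agree with Lebesgue measure on `ℝⁿ`,
restricted to `∂Ω ⊆ ℝⁿ⁺¹`. -/
def surfaceMeasure {n : ℕ} (Ω : Set (EuclideanSpace ℝ (Fin (n + 1)))) :
    Measure (EuclideanSpace ℝ (Fin (n + 1))) :=
  (Measure.euclideanHausdorffMeasure n).restrict (frontier Ω)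

/-- The surface area of the unit sphere of `ℝᵐ` (so of dimension `m - 1`). -/
def sphereArea (m : ℕ) : ℝ :=
  (volume : Measure (EuclideanSpace ℝ (Fin m))).toSphere.real univ

/-- The constant of the stay-away estimate, in terms of the dimension `n ≥ 2`, the lower density
bound `ρ₀`, the radius `κ` and the diameter `D` of the body. -/
def stayAwayConst (n : ℕ) (ρ₀ κ D : ℝ) : ℝ :=
  (2 ^ (n - 2) * ρ₀ * sphereArea (n - 1) / (n * (n + 1))
    * min (κ ^ 2 / (48 * D ^ 2 + 2 * κ ^ 2)) (min (κ / (8 * D)) (1 / 16)) ^ n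
    * ∫ φ in (0 : ℝ)..(Real.pi / 2), Real.cos φ ^ (n + 2) * Real.sin φ ^ (n - 2))
  ^ (-(1 / ((n : ℝ) + 2)))

end StayAway

end

/-! Kantorovich duality gives an optimal coupling `γ` concentrated on the `c`-subdifferential of `u`
(`exists_optimal_coupling`). For the quadratic cost, two points of the `c`-subdifferential form a
monotone pair: `⟪X - X₀, Y - Y₀⟫ ≥ 0` for `γ`-almost every `(X, Y)`, where `Y₀` is the given image
of `X₀`. So a large tangential displacement `p` at `X₀` forces nearby points to move as well, and
this has a cost.

Write `Y₀ - X₀ = p e + t N`, with `N` the outward normal at `X₀` and `e` a unit tangent vector. By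
convexity, `t` and `⟪N, X - X₀⟫` are both nonpositive for `X` in the boundary, so the normal
components only help: `⟪X - X₀, Y₀ - X₀⟫ ≥ p s` with `s = ⟪e, X - X₀⟫`. If `r` is the length of the
tangential part of `X - X₀` and `‖X - X₀‖ ≤ 2r`, then Cauchy-Schwarz gives `‖X - Y‖ ≥ (p s / r - 4r)
/ 2` (`cost_ge_of_monotone`).

Enough points `X` satisfy this: normals at distance less than `κ` differ by less than 60°, so the
boundary points with `‖X - X₀‖ ≤ 2r` project onto the whole tangent disc of radius `κ / 2`
(`exists_frontier_above_tangent`). The projection is 1-Lipschitz, so Hausdorff measure on the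
boundary dominates Lebesgue measure on the disc, and `W₂²` is at least `ρ₀` times the integral of
`coneCost` over the tangent hyperplane (`lintegral_coneCost_le_W₂_sq`). In polar coordinates this
integral is bounded below by a constant times `p ^ (n + 2)` (`ofReal_le_lintegral_coneCost`);
solving for `p` gives the estimate. -/

namespace StayAway

/-! ### Kantorovich duality on a compact metric space -/

section Duality

set_option linter.unusedSectionVars false

variable {K : Type*} [MetricSpace K] [CompactSpace K] [MeasurableSpace K] [BorelSpace K]

/-- The function `(x, y) ↦ φ x + ψ y` on `K × K`. -/
def sumFn (φ ψ : C(K, ℝ)) : C(K × K, ℝ) :=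
  φ.comp ContinuousMap.fst + ψ.comp ContinuousMap.snd

lemma sumFn_apply (φ ψ : C(K, ℝ)) (p : K × K) : sumFn φ ψ p = φ p.1 + ψ p.2 := rfl

/-- The values `∫ φ dμ + ∫ ψ dν` over the pairs with `f (x, y) ≤ φ x + ψ y`. -/
def majorantValues (μ ν : Measure K) (f : C(K × K, ℝ)) : Set ℝ :=
  {t | ∃ φ ψ : C(K, ℝ), (∀ p, f p ≤ sumFn φ ψ p) ∧ t = ∫ x, φ x ∂μ + ∫ y, ψ y ∂ν}

/-- The infimum of `∫ φ dμ + ∫ ψ dν` over the pairs with `f (x, y) ≤ φ x + ψ y`: the sublinear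
functional behind Kantorovich duality. -/
noncomputable def majorantInf (μ ν : Measure K) (f : C(K × K, ℝ)) : ℝ := sInf (majorantValues μ ν f)

lemma integrable_continuousMap {X : Type*} [TopologicalSpace X] [CompactSpace X]
    [MeasurableSpace X] [BorelSpace X] (μ : Measure X) [IsFiniteMeasure μ] (φ : C(X, ℝ)) :
    Integrable φ μ :=
  φ.continuous.integrable_of_hasCompactSupport (HasCompactSupport.of_compactSpace φ)

variable (μ ν : Measure K) [IsProbabilityMeasure μ] [IsProbabilityMeasure ν]

lemma majorantValues_nonempty (f : C(K × K, ℝ)) : (majorantValues μ ν f).Nonempty :=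
  ⟨_, ContinuousMap.const K ‖f‖, 0, fun p => by
    simpa [sumFn_apply] using (le_abs_self _).trans (f.norm_coe_le_norm p), rfl⟩

/-- Integrate the pointwise inequality in one variable at a time; both measures have mass one. This
bounds the set of values below, without which its real `sInf` would be meaningless. -/
lemma le_of_mem_majorantValues {f : C(K × K, ℝ)} {m t : ℝ} (hm : ∀ p, m ≤ f p)
    (ht : t ∈ majorantValues μ ν f) : m ≤ t := by
  obtain ⟨φ, ψ, h, rfl⟩ := ht
  have h1 : ∀ y, m - ψ y ≤ ∫ x, φ x ∂μ := fun y => by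
    have := integral_mono (μ := μ) (integrable_const (m - ψ y)) (integrable_continuousMap μ φ)
      (fun x => by
        have := (hm (x, y)).trans (h (x, y))
        rw [sumFn_apply] at this
        simp only at this ⊢
        linarith)
    simpa using this
  have h2 := integral_mono (μ := ν) (integrable_const (m - ∫ x, φ x ∂μ))
    (integrable_continuousMap ν ψ) (fun y => by have := h1 y; simp only; linarith)
  simp only [integral_const, probReal_univ, one_smul] at h2
  linarith

lemma majorantValues_bddBelow (f : C(K × K, ℝ)) : BddBelow (majorantValues μ ν f) :=
  ⟨-‖f‖, fun _ ht => le_of_mem_majorantValues μ ν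
    (fun p => (abs_le.mp (f.norm_coe_le_norm p)).1) ht⟩

lemma majorantInf_le (f : C(K × K, ℝ)) (φ ψ : C(K, ℝ)) (h : ∀ p, f p ≤ sumFn φ ψ p) :
    majorantInf μ ν f ≤ ∫ x, φ x ∂μ + ∫ y, ψ y ∂ν :=
  csInf_le (majorantValues_bddBelow μ ν f) ⟨φ, ψ, h, rfl⟩

lemma majorantInf_add_le (f g : C(K × K, ℝ)) :
    majorantInf μ ν (f + g) ≤ majorantInf μ ν f + majorantInf μ ν g := by
  have key : ∀ s ∈ majorantValues μ ν f, ∀ t ∈ majorantValues μ ν g,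
      majorantInf μ ν (f + g) ≤ s + t := by
    rintro _ ⟨φ, ψ, h, rfl⟩ _ ⟨φ', ψ', h', rfl⟩
    refine (majorantInf_le μ ν (f + g) (φ + φ') (ψ + ψ') fun p => ?_).trans_eq ?_
    · have := add_le_add (h p) (h' p)
      simp only [sumFn_apply, ContinuousMap.add_apply] at this ⊢
      linarith
    · simp only [ContinuousMap.add_apply]
      rw [integral_add (integrable_continuousMap μ φ) (integrable_continuousMap μ φ'),
        integral_add (integrable_continuousMap ν ψ) (integrable_continuousMap ν ψ')]
      ring
  have h1 : ∀ s ∈ majorantValues μ ν f, majorantInf μ ν (f + g) - s ≤ majorantInf μ ν g :=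
    fun s hs => le_csInf (majorantValues_nonempty μ ν g) fun t ht => by
      linarith [key s hs t ht]
  have h2 : majorantInf μ ν (f + g) - majorantInf μ ν g ≤ majorantInf μ ν f :=
    le_csInf (majorantValues_nonempty μ ν f) fun s hs => by linarith [h1 s hs]
  linarith

lemma majorantInf_smul_le {r : ℝ} (hr : 0 < r) (f : C(K × K, ℝ)) :
    majorantInf μ ν (r • f) ≤ r * majorantInf μ ν f := by
  rw [← div_le_iff₀' hr]
  refine le_csInf (majorantValues_nonempty μ ν f) ?_
  rintro _ ⟨φ, ψ, h, rfl⟩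
  rw [div_le_iff₀' hr]
  refine (majorantInf_le μ ν (r • f) (r • φ) (r • ψ) fun p => ?_).trans_eq ?_
  · have := mul_le_mul_of_nonneg_left (h p) hr.le
    simp only [sumFn_apply, ContinuousMap.smul_apply, smul_eq_mul] at this ⊢
    linarith
  · simp only [ContinuousMap.smul_apply, smul_eq_mul, integral_const_mul]
    ring

lemma majorantInf_smul {r : ℝ} (hr : 0 < r) (f : C(K × K, ℝ)) :
    majorantInf μ ν (r • f) = r * majorantInf μ ν f := by
  refine le_antisymm (majorantInf_smul_le μ ν hr f) ?_
  have := majorantInf_smul_le μ ν (inv_pos.mpr hr) (r • f)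
  rwa [smul_smul, inv_mul_cancel₀ hr.ne', one_smul, ← div_eq_inv_mul, le_div_iff₀' hr] at this

/-- **Kantorovich duality** on a compact metric space: if every pair `φ, ψ` of continuous functions
with `φ x + ψ y ≤ c (x, y)` satisfies `∫ φ dμ + ∫ ψ dν ≤ M`, then some coupling of `μ` and `ν` has
cost at most `M`. -/
theorem exists_coupling_integral_le (c : C(K × K, ℝ)) (M : ℝ)
    (hM : ∀ φ ψ : C(K, ℝ), (∀ p, sumFn φ ψ p ≤ c p) → ∫ x, φ x ∂μ + ∫ y, ψ y ∂ν ≤ M) :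
    ∃ γ : Measure (K × K), IsProbabilityMeasure γ ∧ γ.map Prod.fst = μ ∧ γ.map Prod.snd = ν ∧
      ∫ p, c p ∂γ ≤ M := by
  set N := majorantInf μ ν with hN
  have N0 : N 0 = 0 := by
    have := majorantInf_smul μ ν (r := 2) (by norm_num) 0
    rw [smul_zero] at this
    linarith
  have hNle : -M ≤ N (-c) := by
    refine le_csInf (majorantValues_nonempty μ ν _) ?_
    rintro _ ⟨φ, ψ, h, rfl⟩
    have := hM (-φ) (-ψ) fun p => by
      have := h p
      simp only [sumFn_apply, ContinuousMap.neg_apply] at this ⊢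
      linarith
    simp only [ContinuousMap.neg_apply, integral_neg] at this
    linarith
  -- Well-definedness on the line spanned by `-c`; only `c = 0` needs an argument.
  have hspan : ∀ r : ℝ, r • (-c) = 0 → r • N (-c) = 0 := by
    intro r hr
    rcases smul_eq_zero.mp hr with h | h
    · simp [h]
    · simp [h, N0]
  -- Hahn-Banach: a linear functional below `N` which agrees with `N` at `-c`, so that `Λ c = -N
  -- (-c) ≤ M`.
  obtain ⟨Λ, hΛ, hΛN⟩ := exists_extension_of_le_sublinear
    (LinearPMap.mkSpanSingleton' (σ := RingHom.id ℝ) (-c) (N (-c)) hspan) N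
    (fun r hr f => majorantInf_smul μ ν hr f)
    (majorantInf_add_le μ ν) (by
      rintro ⟨f, hf⟩
      obtain ⟨r, rfl⟩ := Submodule.mem_span_singleton.mp hf
      rw [LinearPMap.mkSpanSingleton'_apply]
      simp only [RingHom.id_apply, smul_eq_mul]
      rcases lt_trichotomy r 0 with h | h | h
      · have h1 := majorantInf_add_le μ ν (r • (-c)) ((-r) • (-c))
        rw [← add_smul, add_neg_cancel, zero_smul, ← hN, N0, hN,
          majorantInf_smul μ ν (neg_pos.mpr h)] at h1
        rw [hN]
        linarith
      · simp [h, N0]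
      · exact (majorantInf_smul μ ν h _).ge)
  have hΛc : Λ (-c) = N (-c) := by
    have h := Submodule.mem_span_singleton_self (R := ℝ) (-c)
    exact (hΛ ⟨-c, h⟩).trans
      (LinearPMap.mkSpanSingleton'_apply_self (σ := RingHom.id ℝ) (-c) (N (-c)) hspan h)
  have hΛpos : ∀ f : C(K × K, ℝ), 0 ≤ f → 0 ≤ Λ f := by
    intro f hf
    have h1 := (hΛN (-f)).trans (majorantInf_le μ ν (-f) 0 0 fun p => by
      have := hf p
      simpa [sumFn_apply] using this)
    simp only [map_neg, ContinuousMap.zero_apply, integral_zero] at h1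
    linarith
  -- `sumFn φ ψ` and its negative are their own majorants, so domination by `N` becomes equality.
  -- This fixes the marginals of the representing measure.
  have hΛsum : ∀ φ ψ : C(K, ℝ), Λ (sumFn φ ψ) = ∫ x, φ x ∂μ + ∫ y, ψ y ∂ν := by
    intro φ ψ
    refine le_antisymm ((hΛN _).trans (majorantInf_le μ ν _ φ ψ fun p => le_rfl)) ?_
    have h1 := (hΛN (-sumFn φ ψ)).trans (majorantInf_le μ ν _ (-φ) (-ψ) fun p => by
      simp only [sumFn_apply, ContinuousMap.neg_apply]
      linarith)
    simp only [map_neg, ContinuousMap.neg_apply, integral_neg] at h1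
    linarith
  let Λ' : CompactlySupportedContinuousMap (K × K) ℝ →ₚ[ℝ] ℝ :=
    PositiveLinearMap.mk₀
      { toFun := fun f => Λ f.toContinuousMap
        map_add' := fun f g => Λ.map_add f.toContinuousMap g.toContinuousMap
        map_smul' := fun r f => Λ.map_smul r f.toContinuousMap }
      (fun f hf => hΛpos _ hf)
  set γ := RealRMK.rieszMeasure Λ' with hγ
  have hint : ∀ f : C(K × K, ℝ), ∫ p, f p ∂γ = Λ f := fun f =>
    RealRMK.integral_rieszMeasure Λ' (CompactlySupportedContinuousMap.continuousMapEquiv f)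
  have hfst : γ.map Prod.fst = μ := by
    refine ext_of_forall_integral_eq_of_IsFiniteMeasure fun φ => ?_
    rw [integral_map (by fun_prop) φ.continuous.aestronglyMeasurable]
    have h1 := hint (sumFn φ.toContinuousMap 0)
    rw [hΛsum] at h1
    simpa [sumFn_apply] using h1
  have hsnd : γ.map Prod.snd = ν := by
    refine ext_of_forall_integral_eq_of_IsFiniteMeasure fun φ => ?_
    rw [integral_map (by fun_prop) φ.continuous.aestronglyMeasurable]
    have h1 := hint (sumFn 0 φ.toContinuousMap)
    rw [hΛsum] at h1
    simpa [sumFn_apply] using h1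
  refine ⟨γ, ⟨?_⟩, hfst, hsnd, ?_⟩
  · rw [← preimage_univ (f := (Prod.fst : K × K → K)),
      ← Measure.map_apply measurable_fst MeasurableSet.univ, hfst, measure_univ]
  · rw [hint]
    rw [map_neg] at hΛc
    linarith

end Duality

/-! ### The `c`-transform and `c`-convex functions -/

section CConvex

variable {E : Type*} [NormedAddCommGroup E] {R : ℝ}

lemma cost_nonneg (X Y : E) : 0 ≤ cost X Y := by unfold cost; positivity

lemma cost_comm (X Y : E) : cost X Y = cost Y X := by unfold cost; rw [norm_sub_rev]

lemma continuous_cost : Continuous fun p : E × E => cost p.1 p.2 := by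
  unfold cost
  fun_prop

lemma cost_le_add {X X' Y : E} (hX : X ∈ ball (0 : E) R) (hX' : X' ∈ ball (0 : E) R)
    (hY : Y ∈ ball (0 : E) R) : cost X' Y ≤ cost X Y + 2 * R * ‖X - X'‖ := by
  rw [mem_ball_zero_iff] at *
  unfold cost
  have h1 : ‖X' - Y‖ ≤ ‖X - Y‖ + ‖X - X'‖ := by
    rw [norm_sub_rev X X', add_comm]
    exact norm_sub_le_norm_sub_add_norm_sub X' X Y
  have h2 : ‖X' - Y‖ ≤ 2 * R := (norm_sub_le _ _).trans (by linarith)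
  have h3 : ‖X - Y‖ ≤ 2 * R := (norm_sub_le _ _).trans (by linarith)
  nlinarith [norm_nonneg (X - X'), norm_nonneg (X - Y), norm_nonneg (X' - Y)]

/-- A supremum of functions with the common Lipschitz constant `2R` inherits that constant. -/
lemma cTransform_le_add (v : E → EReal) {X X' : E} (hX : X ∈ ball (0 : E) R)
    (hX' : X' ∈ ball (0 : E) R) :
    cTransform R v X ≤ cTransform R v X' + ((2 * R * ‖X - X'‖ : ℝ) : EReal) := by
  refine iSup₂_le fun Y hY => ?_
  refine le_trans ?_ (add_le_add_left
    (le_iSup₂ (f := fun Z (_ : Z ∈ ball (0 : E) R) => ((-cost Z X' : ℝ) : EReal) - v Z) Y hY) _)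
  have hc := cost_le_add hX hX' hY
  rw [cost_comm X' Y, cost_comm X Y] at hc
  induction v Y with
  | bot => rw [EReal.coe_sub_bot, EReal.coe_sub_bot, EReal.top_add_coe]
  | top => simp
  | coe a =>
    norm_cast
    linarith

/-- A `c`-transform which is finite somewhere and never `-∞` on the ball is given there by a
continuous real function. -/
lemma exists_continuous_eq_cTransform {v : E → EReal} (hbot : NeBotOnBall R (cTransform R v))
    (htop : ∃ X ∈ ball (0 : E) R, cTransform R v X ≠ ⊤) :
    ∃ f : E → ℝ, Continuous f ∧ (∀ X ∈ ball (0 : E) R, cTransform R v X = f X) ∧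
      ∃ m : ℝ, ∀ X ∈ ball (0 : E) R, m ≤ f X := by
  obtain ⟨X₀, hX₀, hX₀top⟩ := htop
  have hR : 0 < R := by
    rw [mem_ball_zero_iff] at hX₀
    exact (norm_nonneg _).trans_lt hX₀
  have hne : ∀ X ∈ ball (0 : E) R, cTransform R v X ≠ ⊤ := fun X hX h => by
    have := cTransform_le_add v hX hX₀
    rw [h, top_le_iff] at this
    induction h' : cTransform R v X₀ with
    | bot => rw [h'] at this; simp at this
    | top => exact hX₀top h'
    | coe a => rw [h', ← EReal.coe_add] at this; exact EReal.coe_ne_top _ this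
  have heq : ∀ X ∈ ball (0 : E) R, cTransform R v X = ((cTransform R v X).toReal : EReal) :=
    fun X hX => (EReal.coe_toReal (hne X hX) (hbot X hX)).symm
  have hle : ∀ X ∈ ball (0 : E) R, ∀ X' ∈ ball (0 : E) R,
      (cTransform R v X).toReal ≤ (cTransform R v X').toReal + 2 * R * dist X X' := by
    intro X hX X' hX'
    have := cTransform_le_add v hX hX'
    rw [heq X hX, heq X' hX'] at this
    rw [dist_eq_norm]
    exact_mod_cast this
  have hlip : LipschitzOnWith (2 * R).toNNReal (fun X => (cTransform R v X).toReal)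
      (ball (0 : E) R) := LipschitzOnWith.of_le_add_mul _ fun X hX X' hX' => by
    rw [Real.coe_toNNReal _ (by positivity)]
    exact hle X hX X' hX'
  obtain ⟨f, hf, hfeq⟩ := hlip.extend_real
  refine ⟨f, hf.continuous, fun X hX => by rw [heq X hX, ← hfeq hX],
    (cTransform R v X₀).toReal - 2 * R * (2 * R), fun X hX => ?_⟩
  have h1 := hle X₀ hX₀ X hX
  have h2 : dist X₀ X ≤ 2 * R := by
    rw [mem_ball] at hX hX₀
    linarith [dist_triangle_right X₀ X 0]
  rw [← hfeq hX]
  have := mul_le_mul_of_nonneg_left h2 (by positivity : 0 ≤ 2 * R)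
  linarith

/-- A `c`-convex function and its `c`-transform are given on the ball by continuous real
functions. -/
lemma IsCConvex.exists_continuous {u : E → EReal} (hu : IsCConvex R u) :
    ∃ f g : E → ℝ, Continuous f ∧ Continuous g ∧ (∀ X ∈ ball (0 : E) R, u X = f X) ∧
      (∀ Y ∈ ball (0 : E) R, cTransform R u Y = g Y) ∧
      ∀ X ∈ ball (0 : E) R, ∀ Y ∈ ball (0 : E) R, 0 ≤ cost X Y + f X + g Y := by
  obtain ⟨hbot, ⟨X₁, hX₁, htop⟩, v, -, hv⟩ := hu
  obtain ⟨f, hf, hfeq, m, hm⟩ := exists_continuous_eq_cTransform (R := R) (v := v)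
    (fun X hX => hv X hX ▸ hbot X hX) ⟨X₁, hX₁, hv X₁ hX₁ ▸ htop⟩
  have huf : ∀ X ∈ ball (0 : E) R, u X = f X := fun X hX => (hv X hX).trans (hfeq X hX)
  have hlow : ∀ X ∈ ball (0 : E) R, ∀ Y, ((-cost X Y - f X : ℝ) : EReal) ≤ cTransform R u Y := by
    intro X hX Y
    refine le_trans ?_ (le_iSup₂
      (f := fun Z (_ : Z ∈ ball (0 : E) R) => ((-cost Z Y : ℝ) : EReal) - u Z) X hX)
    rw [huf X hX]
    norm_cast
  obtain ⟨g, hg, hgeq, -⟩ := exists_continuous_eq_cTransform (R := R) (v := u)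
    (fun Y hY h => by
      have := hlow X₁ hX₁ Y
      rw [h, le_bot_iff] at this
      exact EReal.coe_ne_bot _ this)
    ⟨X₁, hX₁, fun h => by
      have : cTransform R u X₁ ≤ ((-m : ℝ) : EReal) := iSup₂_le fun X hX => by
        rw [huf X hX]
        have h1 := hm X hX
        have h2 := cost_nonneg X X₁
        norm_cast
        linarith
      rw [h, top_le_iff] at this
      exact EReal.coe_ne_top _ this⟩
  refine ⟨f, g, hf, hg, huf, hgeq, fun X hX Y hY => ?_⟩
  have := hlow X hX Y
  rw [hgeq Y hY] at this
  norm_cast at this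
  linarith

/-- A pair of functions on a compact set `K` with `φ X + ψ Y ≤ c (X, Y)` is improved by a
`c`-convex function and its transform. -/
lemma exists_isCConvex_le {K : Set E} [CompactSpace K] [Nonempty K] (hKR : K ⊆ ball (0 : E) R)
    (φ ψ : C(K, ℝ)) (h : ∀ X Y : K, φ X + ψ Y ≤ cost (X : E) Y) :
    ∃ w : E → EReal, IsCConvex R w ∧ (∀ X : K, w X ≤ ((-φ X : ℝ) : EReal)) ∧
      ∀ Y : K, cTransform R w Y ≤ ((-ψ Y : ℝ) : EReal) := by
  classical
  -- The value `⊤` off `K` removes those points from the supremum. The witness is `w = v^c`: the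
  -- constraint gives `w ≤ -φ` on `K`, and `w^c ≤ -ψ` there is the general fact `v^{cc} ≤ v`.
  set v : E → EReal := fun Y => if hY : Y ∈ K then ((-ψ ⟨Y, hY⟩ : ℝ) : EReal) else ⊤ with hvdef
  have hv : ∀ Y : K, v Y = ((-ψ Y : ℝ) : EReal) := fun Y => by simp [hvdef]
  have hlow : ∀ (Y : K) (X : E), ((-cost (Y : E) X + ψ Y : ℝ) : EReal) ≤ cTransform R v X := by
    intro Y X
    refine le_trans ?_ (le_iSup₂
      (f := fun Z (_ : Z ∈ ball (0 : E) R) => ((-cost Z X : ℝ) : EReal) - v Z) (Y : E) (hKR Y.2))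
    rw [hv]
    norm_cast
    linarith
  have hup : ∀ (X : E) (a : ℝ), (∀ Y : K, -cost (Y : E) X + ψ Y ≤ a) →
      cTransform R v X ≤ (a : EReal) := by
    intro X a ha
    refine iSup₂_le fun Y _ => ?_
    by_cases hY : Y ∈ K
    · have := ha ⟨Y, hY⟩
      rw [hv ⟨Y, hY⟩]
      norm_cast
      simp only at this
      linarith
    · simp [hvdef, hY]
  obtain ⟨Y₀⟩ := ‹Nonempty K›
  refine ⟨cTransform R v, ⟨fun X _ hbot => ?_, ⟨Y₀, hKR Y₀.2, fun htop => ?_⟩, v, ?_, fun _ _ => rfl⟩,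
    fun X => hup X _ fun Y => ?_, fun Y => iSup₂_le fun X _ => ?_⟩
  · have := hlow Y₀ X
    rw [hbot, le_bot_iff] at this
    exact EReal.coe_ne_bot _ this
  · have := hup Y₀ ‖ψ‖ fun Y => by
      have h1 := (abs_le.mp (ψ.norm_coe_le_norm Y)).2
      have h2 := cost_nonneg (Y : E) Y₀
      linarith
    rw [htop, top_le_iff] at this
    exact EReal.coe_ne_top _ this
  · intro X _
    by_cases hX : X ∈ K
    · rw [hv ⟨X, hX⟩]
      exact EReal.coe_ne_bot _
    · simp [hvdef, hX]
  · have := h X Y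
    rw [cost_comm] at this
    linarith
  · have h1 := hlow Y X
    induction h2 : cTransform R v X with
    | bot => rw [h2, le_bot_iff] at h1; exact absurd h1 (EReal.coe_ne_bot _)
    | top => simp
    | coe a =>
      rw [h2] at h1
      norm_cast at h1 ⊢
      rw [cost_comm] at h1
      linarith

end CConvex

/-! ### Optimal couplings and the `c`-subdifferential -/

section Optimal

set_option linter.unusedSectionVars false

variable {E : Type*} [NormedAddCommGroup E] [MeasurableSpace E] [BorelSpace E] {R : ℝ}

lemma integrable_of_ae_mem_isCompact {X : Type*} [TopologicalSpace X] [T2Space X]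
    [MeasurableSpace X] [BorelSpace X] {μ : Measure X} [IsFiniteMeasure μ] {K : Set X}
    (hK : IsCompact K) (hμ : ∀ᵐ x ∂μ, x ∈ K) {f : X → ℝ} (hf : Continuous f) :
    Integrable f μ := by
  rw [← Measure.restrict_eq_self_of_ae_mem hμ]
  exact hf.continuousOn.integrableOn_compact hK

lemma dualValue_eq {μ ν : Measure E} {u : E → EReal} {f g : E → ℝ}
    (hμ : ∀ᵐ x ∂μ, x ∈ ball (0 : E) R) (hν : ∀ᵐ x ∂ν, x ∈ ball (0 : E) R)
    (hf : ∀ X ∈ ball (0 : E) R, u X = f X)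
    (hg : ∀ Y ∈ ball (0 : E) R, cTransform R u Y = g Y) :
    dualValue R μ ν u = -(∫ X, f X ∂μ) - ∫ Y, g Y ∂ν := by
  unfold dualValue
  rw [integral_congr_ae (hμ.mono fun X hX => by simp only [hf X hX, EReal.toReal_coe] :
      (fun X => (u X).toReal) =ᵐ[μ] f),
    integral_congr_ae (hν.mono fun X hX => by simp only [hg X hX, EReal.toReal_coe] :
      (fun Y => (cTransform R u Y).toReal) =ᵐ[ν] g)]

/-- Weak duality: the dual value bounds the cost of every coupling from below. -/
lemma dualValue_le_of_mem_couplings [SecondCountableTopology E] {K : Set E} (hK : IsCompact K)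
    {μ ν : Measure E}
    {γ : Measure (E × E)} (hγ : γ ∈ couplings μ ν)
    (hμ : ∀ᵐ x ∂μ, x ∈ K) (hν : ∀ᵐ x ∂ν, x ∈ K) {f g : E → ℝ} (hf : Continuous f)
    (hg : Continuous g) (h : ∀ X ∈ K, ∀ Y ∈ K, 0 ≤ cost X Y + f X + g Y) :
    ENNReal.ofReal (-(∫ X, f X ∂μ) - ∫ Y, g Y ∂ν)
      ≤ ∫⁻ p, ENNReal.ofReal (cost p.1 p.2) ∂γ := by
  obtain ⟨hprob, rfl, rfl⟩ := hγ
  have h1 := ae_of_ae_map measurable_fst.aemeasurable hμ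
  have h2 := ae_of_ae_map measurable_snd.aemeasurable hν
  have hmem : ∀ᵐ p ∂γ, p ∈ K ×ˢ K := by filter_upwards [h1, h2] with p hp hp' using ⟨hp, hp'⟩
  have hint : ∀ {F : E × E → ℝ}, Continuous F → Integrable F γ :=
    fun hF => integrable_of_ae_mem_isCompact (hK.prod hK) hmem hF
  rw [← ofReal_integral_eq_lintegral_ofReal (hint continuous_cost)
    (Filter.Eventually.of_forall fun p => cost_nonneg _ _)]
  refine ENNReal.ofReal_le_ofReal ?_
  rw [integral_map measurable_fst.aemeasurable hf.aestronglyMeasurable,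
    integral_map measurable_snd.aemeasurable hg.aestronglyMeasurable, ← integral_neg,
    ← integral_sub (hint (by fun_prop)) (hint (by fun_prop))]
  refine integral_mono_ae (hint (by fun_prop)) (hint continuous_cost) ?_
  filter_upwards [hmem] with p hp
  have := h p.1 hp.1 p.2 hp.2
  linarith

/-- For a maximizing pair there is an optimal coupling which is concentrated on the
`c`-subdifferential. -/
theorem exists_optimal_coupling [SecondCountableTopology E] {K : Set E} (hK : IsCompact K)
    (hKR : K ⊆ ball (0 : E) R) {μ ν : Measure E} [IsProbabilityMeasure μ] [IsProbabilityMeasure ν]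
    (hμ : ∀ᵐ x ∂μ, x ∈ K) (hν : ∀ᵐ x ∂ν, x ∈ K) {u : E → EReal}
    (hu : IsDualMaximizer R μ ν u) :
    ∃ (γ : Measure (E × E)) (f : E → ℝ), γ.map Prod.fst = μ ∧ (∀ X ∈ K, u X = f X) ∧
      (∀ᵐ p ∂γ, p.1 ∈ K ∧ ∀ Y ∈ K, -cost Y p.2 + cost p.1 p.2 + f p.1 ≤ f Y) ∧
      ∫⁻ p, ENNReal.ofReal (cost p.1 p.2) ∂γ ≤ ENNReal.ofReal (W₂ μ ν ^ 2) := by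
  obtain ⟨f, g, hf, hg, huf, hug, hfg⟩ := hu.1.exists_continuous
  have hμR := hμ.mono fun X hX => hKR hX
  have hνR := hν.mono fun X hX => hKR hX
  have hfgK : ∀ X ∈ K, ∀ Y ∈ K, 0 ≤ cost X Y + f X + g Y :=
    fun X hX Y hY => hfg X (hKR hX) Y (hKR hY)
  have hD := dualValue_eq hμR hνR huf hug
  have : CompactSpace K := isCompact_iff_compactSpace.mp hK
  have : Nonempty K := by
    obtain ⟨X, hX⟩ := hμ.exists
    exact ⟨⟨X, hX⟩⟩
  set j : K → E := Subtype.val with hj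
  have hjc : Continuous j := continuous_subtype_val
  have hjm : MeasurableEmbedding j := MeasurableEmbedding.subtype_coe hK.measurableSet
  have hmap : ∀ {m : Measure E}, (∀ᵐ x ∂m, x ∈ K) → (m.comap j).map j = m := fun {m} hm => by
    rw [map_comap_subtype_coe hK.measurableSet, Measure.restrict_eq_self_of_ae_mem hm]
  have hprob : ∀ {m : Measure E} [IsProbabilityMeasure m], (∀ᵐ x ∂m, x ∈ K) →
      IsProbabilityMeasure (m.comap j) := fun {m} _ hm => ⟨by
    rw [← preimage_univ (f := j), ← Measure.map_apply hjm.measurable MeasurableSet.univ, hmap hm,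
      measure_univ]⟩
  have := hprob hμ
  have := hprob hν
  have hintmap : ∀ {m : Measure E}, (∀ᵐ x ∂m, x ∈ K) → ∀ F : E → ℝ,
      ∫ X, F X ∂m = ∫ X : K, F X ∂(m.comap j) := fun {m} hm F => by
    rw [← hjm.integral_map, hmap hm]
  let c : C(K × K, ℝ) := ⟨fun p => cost (p.1 : E) p.2,
    continuous_cost.comp (hjc.prodMap hjc)⟩
  -- Every admissible pair is improved by a `c`-convex one, so the maximal dual value serves as the
  -- bound `M`.
  obtain ⟨γ, hγ, hγ1, hγ2, hγc⟩ := exists_coupling_integral_le (μ.comap j) (ν.comap j) c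
    (dualValue R μ ν u) (by
      intro φ ψ hφψ
      obtain ⟨w, hw, hwφ, hwψ⟩ := exists_isCConvex_le hKR φ ψ fun X Y => hφψ (X, Y)
      refine le_trans ?_ (hu.2 w hw)
      obtain ⟨f', g', hf', hg', hwf, hwg, -⟩ := hw.exists_continuous
      rw [dualValue_eq hμR hνR hwf hwg, hintmap hμ, hintmap hν]
      have h1 : ∫ X : K, f' X ∂(μ.comap j) ≤ ∫ X : K, -φ X ∂(μ.comap j) :=
        integral_mono (integrable_continuousMap _ ⟨fun X : K => f' X, by fun_prop⟩)
          (integrable_continuousMap _ (-φ)) fun X => by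
            have := hwφ X
            rw [hwf X (hKR X.2)] at this
            exact_mod_cast this
      have h2 : ∫ X : K, g' X ∂(ν.comap j) ≤ ∫ X : K, -ψ X ∂(ν.comap j) :=
        integral_mono (integrable_continuousMap _ ⟨fun X : K => g' X, by fun_prop⟩)
          (integrable_continuousMap _ (-ψ)) fun X => by
            have := hwψ X
            rw [hwg X (hKR X.2)] at this
            exact_mod_cast this
      rw [integral_neg] at h1 h2
      linarith)
  have hcint : ∫ p : K × K, cost (p.1 : E) p.2 ∂γ ≤ dualValue R μ ν u := hγc
  have hint : ∀ {F : K × K → ℝ}, Continuous F → Integrable F γ :=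
    fun hF => integrable_continuousMap γ ⟨_, hF⟩
  have hcostc : Continuous fun p : K × K => cost (p.1 : E) p.2 := c.continuous
  -- Complementary slackness: the integrand is nonnegative and its integral is at most zero, as the
  -- cost of `γ` does not exceed the dual value.
  have hzero : ∀ᵐ p : K × K ∂γ, cost (p.1 : E) p.2 + f p.1 + g p.2 = 0 := by
    have h0 : 0 ≤ fun p : K × K => cost (p.1 : E) p.2 + f p.1 + g p.2 :=
      fun p => hfgK _ p.1.2 _ p.2.2
    refine (integral_eq_zero_iff_of_nonneg h0 (hint (by fun_prop))).mp
      (le_antisymm ?_ (integral_nonneg h0))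
    rw [integral_add (hint (by fun_prop)) (hint (by fun_prop)),
      integral_add (hint (by fun_prop)) (hint (by fun_prop))]
    have h1 : ∫ X, f X ∂μ = ∫ p : K × K, f p.1 ∂γ := by
      rw [hintmap hμ, ← hγ1, integral_map (by fun_prop)
        (Continuous.aestronglyMeasurable (by fun_prop))]
    have h2 : ∫ X, g X ∂ν = ∫ p : K × K, g p.2 ∂γ := by
      rw [hintmap hν, ← hγ2, integral_map (by fun_prop)
        (Continuous.aestronglyMeasurable (by fun_prop))]
    rw [← h1, ← h2]
    linarith
  have hjj : MeasurableEmbedding (Prod.map j j) := hjm.prodMap hjm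
  have hm1 : (γ.map (Prod.map j j)).map Prod.fst = μ := by
    rw [Measure.map_map measurable_fst hjj.measurable, show Prod.fst ∘ Prod.map j j = j ∘ Prod.fst
      from rfl, ← Measure.map_map hjm.measurable measurable_fst, hγ1, hmap hμ]
  have hm2 : (γ.map (Prod.map j j)).map Prod.snd = ν := by
    rw [Measure.map_map measurable_snd hjj.measurable, show Prod.snd ∘ Prod.map j j = j ∘ Prod.snd
      from rfl, ← Measure.map_map hjm.measurable measurable_snd, hγ2, hmap hν]
  have hlint : ∫⁻ p, ENNReal.ofReal (cost p.1 p.2) ∂(γ.map (Prod.map j j))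
      = ENNReal.ofReal (∫ p : K × K, cost (p.1 : E) p.2 ∂γ) := by
    rw [hjj.lintegral_map, ofReal_integral_eq_lintegral_ofReal (hint hcostc)
      (Filter.Eventually.of_forall fun p => cost_nonneg _ _)]
    rfl
  have hmemc : γ.map (Prod.map j j) ∈ couplings μ ν :=
    ⟨Measure.isProbabilityMeasure_map hjj.measurable.aemeasurable, hm1, hm2⟩
  refine ⟨γ.map (Prod.map j j), f, hm1, fun X hX => huf X (hKR hX), ?_, ?_⟩
  · rw [hjj.ae_map_iff]
    filter_upwards [hzero] with p hp
    refine ⟨p.1.2, fun Y hY => ?_⟩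
    have := hfgK Y hY p.2 p.2.2
    simp only [Prod.map_fst, Prod.map_snd, hj]
    linarith
  -- Finiteness matters: `toReal` in `W₂` would send `⊤` to `0`. Optimality then follows from weak
  -- duality.
  · have hfin : (⨅ γ ∈ couplings μ ν, ∫⁻ p, ENNReal.ofReal (cost p.1 p.2) ∂γ) ≠ ⊤ :=
      ne_top_of_le_ne_top (by rw [hlint]; exact ENNReal.ofReal_ne_top) (iInf₂_le _ hmemc)
    rw [W₂, Real.sq_sqrt ENNReal.toReal_nonneg, ENNReal.ofReal_toReal hfin, hlint]
    refine le_iInf₂ fun γ' hγ' => ?_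
    refine (ENNReal.ofReal_le_ofReal (hcint.trans_eq hD)).trans ?_
    exact dualValue_le_of_mem_couplings hK hγ' hμ hν hf hg hfgK

end Optimal

/-! ### Boundary geometry of a `C¹` convex body -/

section ConvexGeometry

open Filter Topology

variable {E : Type*} [NormedAddCommGroup E] [InnerProductSpace ℝ E] {Ω : Set E}

lemma exists_mem_frontier_of_isPreconnected {X : Type*} [TopologicalSpace X] {s t : Set X}
    (hs : IsClosed s) (ht : IsPreconnected t) (h1 : (t ∩ s).Nonempty) (h2 : (t ∩ sᶜ).Nonempty) :
    (t ∩ frontier s).Nonempty := by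
  by_contra hne
  rw [hs.frontier_eq] at hne
  have hint : ∀ x ∈ t, x ∈ s → x ∈ interior s := fun x hxt hxs => by
    by_contra hx
    exact hne ⟨x, hxt, hxs, hx⟩
  obtain ⟨x, hxt, hxs⟩ := h1
  obtain ⟨y, -, hy, hy'⟩ := ht _ _ isOpen_interior hs.isOpen_compl
    (fun z hz => (em (z ∈ s)).imp (hint z hz) id) ⟨x, hxt, hint x hxt hxs⟩ h2
  exact hy' (interior_subset hy)

/-- `normal` is an epsilon choice, so existence of a supporting hyperplane (Hahn-Banach) is all that
is needed; uniqueness never enters. -/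
lemma IsConvexBody.normal_mem [CompleteSpace E] (hΩ : IsConvexBody Ω) {X : E}
    (hX : X ∈ frontier Ω) : normal Ω X ∈ outwardNormals Ω X := by
  refine Classical.epsilon_spec (p := fun V => V ∈ outwardNormals Ω X) ?_
  obtain ⟨f, hf⟩ := geometric_hahn_banach_open_point hΩ.convex.interior isOpen_interior hX.2
  have hfΩ : ∀ Y ∈ Ω, f Y ≤ f X := by
    have hcl : closure (interior Ω) ⊆ {Y | f Y ≤ f X} :=
      closure_minimal (fun Y hY => (hf Y hY).le) (isClosed_le f.continuous continuous_const)
    rw [hΩ.convex.closure_interior_eq_closure_of_nonempty_interior ⟨0, hΩ.zero_mem_interior⟩]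
      at hcl
    exact fun Y hY => hcl (subset_closure hY)
  set V := (InnerProductSpace.toDual ℝ E).symm f with hV
  have hVf : ∀ Y, ⟪V, Y⟫ = f Y := fun Y => InnerProductSpace.toDual_symm_apply
  have hV0 : V ≠ 0 := fun h => by
    have := hf 0 hΩ.zero_mem_interior
    rw [← hVf, ← hVf, h, inner_zero_left, inner_zero_left] at this
    exact this.false
  have hpos : 0 < ‖V‖ := norm_pos_iff.mpr hV0
  refine ⟨‖V‖⁻¹ • V, ?_, fun Y hY => ?_⟩
  · rw [norm_smul, norm_inv, norm_norm, inv_mul_cancel₀ hpos.ne']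
  · rw [real_inner_smul_left, inner_sub_right, hVf, hVf]
    exact mul_nonpos_of_nonneg_of_nonpos (by positivity) (by linarith [hfΩ Y hY])

/-- Normals at boundary points at distance less than `κ` enclose an angle of less than `60°`. -/
lemma IsConvexBody.half_lt_inner_normal [CompleteSpace E] (hΩ : IsConvexBody Ω) {Θ κ : ℝ}
    (hΘ : 1 / 2 ≤ Θ) (hκ : normalModulus Ω κ < Real.sqrt (2 - 2 * Θ)) {X Y : E}
    (hX : X ∈ frontier Ω) (hY : Y ∈ frontier Ω) (h : ‖X - Y‖ < κ) :
    1 / 2 < ⟪normal Ω X, normal Ω Y⟫ := by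
  have h1 : ∀ Z ∈ frontier Ω, ‖normal Ω Z‖ = 1 := fun Z hZ => (hΩ.normal_mem hZ).1
  have hbdd : BddAbove {t | ∃ X₁ ∈ frontier Ω, ∃ X₂ ∈ frontier Ω,
      ‖X₁ - X₂‖ < κ ∧ t = ‖normal Ω X₁ - normal Ω X₂‖} := by
    refine ⟨2, ?_⟩
    rintro _ ⟨X₁, hX₁, X₂, hX₂, -, rfl⟩
    refine (norm_sub_le _ _).trans ?_
    rw [h1 X₁ hX₁, h1 X₂ hX₂]
    norm_num
  have hlt : ‖normal Ω X - normal Ω Y‖ < Real.sqrt (2 - 2 * Θ) :=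
    (le_csSup hbdd ⟨X, hX, Y, hY, h, rfl⟩).trans_lt hκ
  have hsq := (Real.lt_sqrt (norm_nonneg _)).mp hlt
  rw [norm_sub_sq_real, h1 X hX, h1 Y hY] at hsq
  linarith

/-- At a boundary point of a body with `C¹` boundary, every direction which makes an obtuse angle
with an outward normal points into the body. -/
lemma HasC1Boundary.eventually_mem (hC1 : HasC1Boundary Ω) (hcl : IsClosed Ω) {X V d : E}
    (hX : X ∈ frontier Ω) (hV : V ∈ outwardNormals Ω X) (hd : ⟪V, d⟫ < 0) :
    ∀ᶠ s in 𝓝[>] (0 : ℝ), X + s • d ∈ Ω := by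
  obtain ⟨U, hU, hXU, f, hf, hf0, hΩU⟩ := hC1 X hX
  have hfd : HasFDerivAt f (fderiv ℝ f X) X :=
    ((hf.differentiableOn one_ne_zero).differentiableAt (hU.mem_nhds hXU)).hasFDerivAt
  have hfX : f X ≤ 0 := by
    have : X ∈ Ω ∩ U := ⟨hcl.frontier_subset hX, hXU⟩
    rw [hΩU] at this
    exact this.2
  -- It remains to show that `f` strictly decreases along `d`. If not, tilting `-d` slightly towards
  -- a descent direction `v₀` yields a descent direction, hence one into `Ω`, with positive inner
  -- product with `V`: a contradiction.
  have key : ∀ v, fderiv ℝ f X v < 0 → ∀ᶠ s in 𝓝[>] (0 : ℝ), X + s • v ∈ Ω := by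
    intro v hv
    have hline : HasDerivAt (fun s : ℝ => X + s • v) v 0 := by
      simpa using ((hasDerivAt_id (0 : ℝ)).smul_const v).const_add X
    have hder : HasDerivAt (fun s : ℝ => f (X + s • v)) (fderiv ℝ f X v) 0 := by
      have hfd' : HasFDerivAt f (fderiv ℝ f X) (X + (0 : ℝ) • v) := by simpa using hfd
      exact hfd'.comp_hasDerivAt (0 : ℝ) hline
    have hneg := (hasDerivAt_iff_tendsto_slope.mp hder).eventually (gt_mem_nhds hv)
    have hneg' := hneg.filter_mono (nhdsWithin_mono 0 (fun s (hs : 0 < s) => hs.ne'))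
    have hUs : ∀ᶠ s in 𝓝 (0 : ℝ), X + s • v ∈ U :=
      hline.continuousAt.eventually_mem (hU.mem_nhds (by simpa using hXU))
    filter_upwards [hneg', hUs.filter_mono nhdsWithin_le_nhds, self_mem_nhdsWithin]
      with s hs hsU hs0
    have hs0 : 0 < s := hs0
    rw [slope_def_field, sub_zero, zero_smul, add_zero, div_neg_iff] at hs
    have : X + s • v ∈ Ω ∩ U := by
      rw [hΩU]
      refine ⟨hsU, ?_⟩
      rcases hs with h | h <;> linarith [h.1, h.2]
    exact this.1
  have hker : ∀ v, fderiv ℝ f X v < 0 → ⟪V, v⟫ ≤ 0 := by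
    intro v hv
    obtain ⟨s, hs, hs0⟩ := ((key v hv).and self_mem_nhdsWithin).exists
    have := hV.2 _ hs
    rw [add_sub_cancel_left, real_inner_smul_right] at this
    exact nonpos_of_mul_nonpos_right this hs0
  refine key d (not_le.mp fun hnn => ?_)
  obtain ⟨v₀, hv₀⟩ : ∃ v, fderiv ℝ f X v < 0 := by
    by_contra! hall
    refine hf0 (ContinuousLinearMap.ext fun v => le_antisymm ?_ (hall v))
    have := hall (-v)
    rw [map_neg] at this
    simpa using this
  have hlim : ∀ᶠ ε in 𝓝[>] (0 : ℝ), 0 < ⟪V, -d + ε • v₀⟫ := by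
    have hc : ContinuousAt (fun ε : ℝ => ⟪V, -d + ε • v₀⟫) 0 := by fun_prop
    refine (hc.eventually (lt_mem_nhds ?_)).filter_mono nhdsWithin_le_nhds
    simpa using hd
  obtain ⟨ε, hε, hε0⟩ := (hlim.and self_mem_nhdsWithin).exists
  have hε0 : 0 < ε := hε0
  refine hε.not_ge (hker _ ?_)
  rw [map_add, map_neg, map_smul, smul_eq_mul]
  nlinarith

/-- Near `X₀` the boundary is a graph over the tangent hyperplane with slope at most `√3`. -/
lemma exists_frontier_above_tangent [CompleteSpace E] (hΩ : IsConvexBody Ω)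
    (hC1 : HasC1Boundary Ω) {Θ κ : ℝ} (hΘ : 1 / 2 ≤ Θ)
    (hκ : normalModulus Ω κ < Real.sqrt (2 - 2 * Θ)) {X₀ x : E} (hX₀ : X₀ ∈ frontier Ω)
    (hx : ⟪normal Ω X₀, x⟫ = 0) (hxκ : 2 * ‖x‖ ≤ κ) :
    ∃ h : ℝ, X₀ + x - h • normal Ω X₀ ∈ frontier Ω ∧ ‖x - h • normal Ω X₀‖ ≤ 2 * ‖x‖ := by
  set N := normal Ω X₀ with hN
  obtain ⟨hN1, hNle⟩ := hΩ.normal_mem hX₀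
  have hcl : IsClosed Ω := hΩ.isCompact.isClosed
  rcases eq_or_ne x 0 with rfl | hx0
  · exact ⟨0, by simpa using hX₀, by simp⟩
  have hxpos : 0 < ‖x‖ := norm_pos_iff.mpr hx0
  have hnorm : ∀ h : ℝ, ‖x - h • N‖ ^ 2 = ‖x‖ ^ 2 + h ^ 2 := fun h => by
    rw [norm_sub_sq_real, real_inner_smul_right, real_inner_comm, hx, norm_smul, hN1,
      Real.norm_eq_abs, mul_one, sq_abs]
    ring
  have h3 : Real.sqrt 3 ^ 2 = 3 := Real.sq_sqrt (by norm_num)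
  have h3pos : 0 < Real.sqrt 3 := by positivity
  -- Slope `√3 = tan 60°`: the vector `d` below then has length exactly `2‖x‖`.
  set H := Real.sqrt 3 * ‖x‖ with hH
  have hHpos : 0 < H := by positivity
  have hnormle : ∀ h : ℝ, 0 ≤ h → h ≤ H → ‖x - h • N‖ ≤ 2 * ‖x‖ := fun h h0 hle => by
    refine abs_le_of_sq_le_sq' ?_ (by positivity) |>.2
    rw [hnorm, mul_pow]
    nlinarith
  set d := x - H • N with hd
  have hdnorm : ‖d‖ ≤ 2 * ‖x‖ := hnormle H hHpos.le le_rfl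
  have hNd : ⟪N, d⟫ = -H := by
    rw [hd, inner_sub_right, hx, real_inner_smul_right, real_inner_self_eq_norm_sq, hN1]
    ring
  have hmem : X₀ + d ∈ Ω := by
    by_contra hnot
    have hev := hC1.eventually_mem hcl hX₀ ⟨hN1, hNle⟩ (by rw [hNd]; linarith : ⟪N, d⟫ < 0)
    obtain ⟨ε, hε, hε0, hε1⟩ := (hev.and (Ioo_mem_nhdsGT (zero_lt_one' ℝ))).exists
    have hpre : IsPreconnected ((fun s : ℝ => X₀ + s • d) '' Icc ε 1) :=
      isPreconnected_Icc.image _ (by fun_prop)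
    obtain ⟨_, ⟨s, ⟨hs1, hs2⟩, rfl⟩, hZ⟩ := exists_mem_frontier_of_isPreconnected hcl hpre
      ⟨X₀ + ε • d, ⟨ε, ⟨le_rfl, hε1.le⟩, rfl⟩, hε⟩
      ⟨X₀ + d, ⟨1, ⟨hε1.le, le_rfl⟩, by simp⟩, hnot⟩
    simp only at hZ
    have hspos : 0 < s := hε0.trans_le hs1
    -- Strictness puts the crossing point at distance less than `κ`, as `normalModulus` requires,
    -- even when `2‖x‖ = κ`.
    have hslt : s < 1 := lt_of_le_of_ne hs2 fun h => hnot (by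
      have := hcl.frontier_subset hZ
      rwa [h, one_smul] at this)
    have hdist : ‖X₀ + s • d - X₀‖ < κ := by
      rw [add_sub_cancel_left, norm_smul, Real.norm_eq_abs, abs_of_pos hspos]
      have : s * ‖d‖ ≤ s * (2 * ‖x‖) := mul_le_mul_of_nonneg_left hdnorm hspos.le
      nlinarith
    have hhalf := hΩ.half_lt_inner_normal hΘ hκ hZ hX₀ hdist
    obtain ⟨hV1, hVle⟩ := hΩ.normal_mem hZ
    set V := normal Ω (X₀ + s • d) with hV
    rw [← hN] at hhalf
    set α := ⟪V, N⟫ with hα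
    -- The body lies behind the supporting hyperplane at the crossing point, and `X₀` is in the
    -- body. Hence `√3 α ‖x‖ ≤ ⟪V, x⟫ ≤ √(1 - α²) ‖x‖`, so `α ≤ 1/2`, against the bound on the angle
    -- between the normals.
    have hVd : 0 ≤ ⟪V, d⟫ := by
      have := hVle X₀ (hcl.frontier_subset hX₀)
      rw [sub_add_cancel_left, inner_neg_right, real_inner_smul_right] at this
      exact nonneg_of_mul_nonneg_right (by linarith : 0 ≤ s * ⟪V, d⟫) hspos
    have hVx : ⟪V, x⟫ ^ 2 ≤ (1 - α ^ 2) * ‖x‖ ^ 2 := by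
      have h1 : ⟪V - α • N, x⟫ = ⟪V, x⟫ := by
        rw [inner_sub_left, real_inner_smul_left, hx]; ring
      have h2 : ‖V - α • N‖ ^ 2 = 1 - α ^ 2 := by
        rw [norm_sub_sq_real, real_inner_smul_right, ← hα, norm_smul, hN1, hV1, Real.norm_eq_abs,
          mul_one, sq_abs]
        ring
      have h3 := abs_real_inner_le_norm (V - α • N) x
      rw [h1] at h3
      rw [← h2, ← mul_pow]
      exact sq_le_sq' (by linarith [neg_abs_le ⟪V, x⟫]) ((le_abs_self _).trans h3)
    have hVd' : H * α ≤ ⟪V, x⟫ := by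
      rw [hd, inner_sub_right, real_inner_smul_right, ← hα] at hVd
      linarith
    have hsq : (H * α) ^ 2 ≤ ⟪V, x⟫ ^ 2 := by
      refine pow_le_pow_left₀ ?_ hVd' 2
      exact mul_nonneg hHpos.le (by linarith)
    have : 3 * α ^ 2 * ‖x‖ ^ 2 ≤ (1 - α ^ 2) * ‖x‖ ^ 2 := by
      refine le_trans (le_of_eq ?_) (hsq.trans hVx)
      rw [hH, mul_pow, mul_pow, h3]
      ring
    have := le_of_mul_le_mul_right this (by positivity)
    nlinarith
  have hup : X₀ + x ∉ interior Ω := fun hint => by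
    have hc : Continuous fun s : ℝ => X₀ + x + s • N := by fun_prop
    have hev : ∀ᶠ s in 𝓝[>] (0 : ℝ), X₀ + x + s • N ∈ Ω :=
      (hc.continuousAt.eventually_mem (by simpa using mem_interior_iff_mem_nhds.mp hint)).filter_mono
        nhdsWithin_le_nhds
    obtain ⟨s, hs, hs0⟩ := (hev.and self_mem_nhdsWithin).exists
    have hs0 : 0 < s := hs0
    have := hNle _ hs
    rw [← hN, show X₀ + x + s • N - X₀ = x + s • N by abel, inner_add_right, hx,
      real_inner_smul_right, real_inner_self_eq_norm_sq, hN1] at this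
    linarith
  by_cases hin : X₀ + x ∈ Ω
  · refine ⟨0, ?_, hnormle 0 le_rfl hHpos.le⟩
    rw [zero_smul, sub_zero]
    exact ⟨subset_closure hin, hup⟩
  -- The segment along `-N` starts outside `Ω` and ends in it at `X₀ + d`, so it meets the boundary.
  have hpre : IsPreconnected ((fun h : ℝ => X₀ + x - h • N) '' Icc 0 H) :=
    isPreconnected_Icc.image _ (by fun_prop)
  obtain ⟨_, ⟨h, ⟨hh0, hhH⟩, rfl⟩, hZ⟩ := exists_mem_frontier_of_isPreconnected hcl hpre
    ⟨X₀ + x - H • N, ⟨H, ⟨hHpos.le, le_rfl⟩, rfl⟩, by rwa [add_sub_assoc]⟩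
    ⟨X₀ + x, ⟨0, ⟨le_rfl, hHpos.le⟩, by simp⟩, hin⟩
  exact ⟨h, hZ, hnormle h hh0 hhH⟩

end ConvexGeometry

/-! ### Displacement forced by monotonicity -/

section Displacement

variable {E : Type*} [NormedAddCommGroup E] [InnerProductSpace ℝ E]

/-- The squared norms cancel: this turns `c`-monotonicity into ordinary monotonicity. -/
lemma cost_add_cost_sub (X Y X' Y' : E) :
    cost X Y' + cost X' Y - cost X Y - cost X' Y' = ⟪X - X', Y - Y'⟫ := by
  unfold cost
  rw [norm_sub_sq_real, norm_sub_sq_real, norm_sub_sq_real, norm_sub_sq_real, inner_sub_left,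
    inner_sub_right, inner_sub_right]
  ring

/-- A point `X` near `X₀`, in a cone about the direction of `Y₀ - X₀`, is displaced by a definite
amount by any map which is monotone along `X - X₀`. -/
lemma cost_ge_of_monotone {X₀ Y₀ X Y : E} {q r : ℝ} (hr : 0 < r) (hq : 4 * r ≤ q)
    (hmono : 0 ≤ ⟪X - X₀, Y - Y₀⟫) (hX : ‖X - X₀‖ ≤ 2 * r) (hY₀ : q * r ≤ ⟪X - X₀, Y₀ - X₀⟫) :
    (q - 4 * r) ^ 2 / 8 ≤ cost X Y := by
  have h1 : ⟪X - X₀, Y - X⟫ =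
      ⟪X - X₀, Y - Y₀⟫ + ⟪X - X₀, Y₀ - X₀⟫ - ‖X - X₀‖ ^ 2 := by
    rw [← real_inner_self_eq_norm_sq, ← inner_add_right, ← inner_sub_right]
    congr 1
    abel
  have h2 := real_inner_le_norm (X - X₀) (Y - X)
  rw [norm_sub_rev Y X] at h2
  have h3 : q * r ≤ 2 * r * (‖X - Y‖ + 2 * r) := by
    have : ‖X - X₀‖ * (‖X - Y‖ + ‖X - X₀‖) ≤ 2 * r * (‖X - Y‖ + 2 * r) := by gcongr
    nlinarith
  have h4 : q ≤ 2 * (‖X - Y‖ + 2 * r) := le_of_mul_le_mul_right (by linarith) hr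
  unfold cost
  have := pow_le_pow_left₀ (by linarith : 0 ≤ (q - 4 * r) / 2)
    (by linarith : (q - 4 * r) / 2 ≤ ‖X - Y‖) 2
  linarith [this, show ((q - 4 * r) / 2) ^ 2 = (q - 4 * r) ^ 2 / 4 by ring]

end Displacement

/-! ### Hausdorff measure under 1-Lipschitz maps -/

section Hausdorff

/-- The image of the `d`-dimensional Hausdorff measure on a set under a 1-Lipschitz map dominates the
volume on any set covered by the image. -/
lemma volume_restrict_le_map_euclideanHausdorffMeasure {X F : Type*} [MetricSpace X]
    [MeasurableSpace X] [BorelSpace X] [NormedAddCommGroup F] [InnerProductSpace ℝ F]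
    [FiniteDimensional ℝ F] [MeasurableSpace F] [BorelSpace F] {d : ℕ}
    (hd : Module.finrank ℝ F = d) {A : Set X} {B : Set F} {Q : X → F}
    (hQ : LipschitzWith 1 Q) (hB : B ⊆ Q '' A) :
    (volume : Measure F).restrict B ≤
      ((Measure.euclideanHausdorffMeasure d : Measure X).restrict A).map Q := by
  refine Measure.le_iff.mpr fun T hT => ?_
  have hQm : Measurable Q := hQ.continuous.measurable
  rw [Measure.restrict_apply hT, Measure.map_apply hQm hT, Measure.restrict_apply (hQm hT), ← hd,
    ← InnerProductSpace.euclideanHausdorffMeasure_eq_volume]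
  have hsub : T ∩ B ⊆ Q '' (Q ⁻¹' T ∩ A) := by
    rintro y ⟨hyT, hyB⟩
    obtain ⟨x, hx, rfl⟩ := hB hyB
    exact ⟨x, ⟨hyT, hx⟩, rfl⟩
  refine (measure_mono hsub).trans ?_
  rw [Measure.euclideanHausdorffMeasure_def, Measure.euclideanHausdorffMeasure_def,
    Measure.smul_apply, Measure.smul_apply]
  gcongr
  have := hQ.hausdorffMeasure_image_le (Nat.cast_nonneg (Module.finrank ℝ F))
    (Q ⁻¹' T ∩ A)
  simpa using this

end Hausdorff

/-! ### Polar coordinates -/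

section Polar

/-- Integration of a radial function in polar coordinates. -/
lemma lintegral_fun_norm_addHaar {E : Type*} [NormedAddCommGroup E] [NormedSpace ℝ E]
    [FiniteDimensional ℝ E] [Nontrivial E] [MeasurableSpace E] [BorelSpace E] (μ : Measure E)
    [μ.IsAddHaarMeasure] {f : ℝ → ℝ≥0∞} (hf : Measurable f) :
    ∫⁻ x, f ‖x‖ ∂μ = μ.toSphere univ *
      ∫⁻ t in Ioi (0 : ℝ), ENNReal.ofReal (t ^ (Module.finrank ℝ E - 1)) * f t := by
  have hfv : Measurable fun t : Ioi (0 : ℝ) => f t := hf.comp measurable_subtype_coe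
  calc
    ∫⁻ x, f ‖x‖ ∂μ = ∫⁻ x : ({(0)}ᶜ : Set E), f ‖x.1‖ ∂(μ.comap (↑)) := by
      rw [lintegral_subtype_comap (measurableSet_singleton _).compl fun x => f ‖x‖,
        restrict_compl_singleton]
    _ = ∫⁻ x, f x.2 ∂μ.toSphere.prod (.volumeIoiPow (Module.finrank ℝ E - 1)) := by
      rw [← μ.measurePreserving_homeomorphUnitSphereProd.lintegral_comp_emb
        (Homeomorph.measurableEmbedding _)]
      simp
    _ = μ.toSphere univ * ∫⁻ t : Ioi (0 : ℝ), f t ∂.volumeIoiPow (Module.finrank ℝ E - 1) := by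
      rw [lintegral_prod (fun x : sphere (0 : E) 1 × Ioi (0 : ℝ) => f x.2)
        (hfv.comp measurable_snd).aemeasurable]
      simp [mul_comm]
    _ = _ := by
      rw [Measure.volumeIoiPow, lintegral_withDensity_eq_lintegral_mul _ (by fun_prop) hfv]
      simp only [Pi.mul_apply]
      rw [lintegral_subtype_comap measurableSet_Ioi fun t : ℝ =>
        ENNReal.ofReal (t ^ (Module.finrank ℝ E - 1)) * f t]

/-- Integration over `ℝ × ℝᵏ⁺¹` of a function of the first coordinate and the norm of the second. -/
lemma lintegral_prod_fun_norm (k : ℕ) {G : ℝ × ℝ → ℝ≥0∞} (hG : Measurable G) :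
    ∫⁻ z : WithLp 2 (ℝ × EuclideanSpace ℝ (Fin (k + 1))), G (z.fst, ‖z.snd‖) =
      ENNReal.ofReal (sphereArea (k + 1)) * ∫⁻ p in polarCoord.target,
        ENNReal.ofReal p.1 * (Ioi (0 : ℝ)).indicator
          (fun t => ENNReal.ofReal (t ^ k) * G (p.1 * Real.cos p.2, t)) (p.1 * Real.sin p.2) := by
  have hmeas : Measurable fun q : ℝ × ℝ => (univ ×ˢ Ioi (0 : ℝ)).indicator
      (fun q : ℝ × ℝ => ENNReal.ofReal (q.2 ^ k) * G q) q :=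
    Measurable.indicator (by fun_prop) (MeasurableSet.univ.prod measurableSet_Ioi)
  calc
    _ = ∫⁻ z : ℝ × EuclideanSpace ℝ (Fin (k + 1)), G (z.1, ‖z.2‖) :=
      (WithLp.volume_preserving_ofLp ℝ (EuclideanSpace ℝ (Fin (k + 1)))).lintegral_comp
        (f := fun z => G (z.1, ‖z.2‖)) (by fun_prop)
    _ = ∫⁻ s : ℝ, ∫⁻ y : EuclideanSpace ℝ (Fin (k + 1)), G (s, ‖y‖) := by
      rw [Measure.volume_eq_prod, lintegral_prod _ (by fun_prop)]
    _ = ∫⁻ s : ℝ, ENNReal.ofReal (sphereArea (k + 1)) *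
          ∫⁻ t in Ioi (0 : ℝ), ENNReal.ofReal (t ^ k) * G (s, t) := by
      refine lintegral_congr fun s => ?_
      rw [lintegral_fun_norm_addHaar volume (f := fun t => G (s, t)) (by fun_prop), sphereArea,
        measureReal_def, ENNReal.ofReal_toReal (measure_ne_top _ _)]
      simp
    -- Extension by zero to `t ≤ 0` makes planar polar coordinates applicable to the pair `(s, t)`.
    _ = ENNReal.ofReal (sphereArea (k + 1)) * ∫⁻ s : ℝ, ∫⁻ t : ℝ,
          (univ ×ˢ Ioi (0 : ℝ)).indicator
            (fun q : ℝ × ℝ => ENNReal.ofReal (q.2 ^ k) * G q) (s, t) := by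
      rw [lintegral_const_mul' _ _ ENNReal.ofReal_ne_top]
      congr 1
      refine lintegral_congr fun s => ?_
      rw [← lintegral_indicator measurableSet_Ioi]
      refine lintegral_congr fun t => ?_
      by_cases ht : 0 < t <;> simp [indicator, ht]
    _ = _ := by
      rw [← lintegral_prod _ hmeas.aemeasurable, ← Measure.volume_eq_prod,
        ← lintegral_comp_polarCoord_symm]
      congr 1
      refine lintegral_congr fun p => ?_
      rw [polarCoord_symm_apply, smul_eq_mul]
      congr 1
      by_cases ht : 0 < p.1 * Real.sin p.2 <;> simp [indicator, ht]

end Polar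

/-! ### The integral of the model cost -/

section RadialIntegral

/-- The radial part of the lower bound for the transport cost. -/
lemma integral_pow_mul_sq (k : ℕ) {b : ℝ} (hb : b ≠ 0) (q : ℝ) :
    ∫ r in (0 : ℝ)..b * q, r ^ (k + 1) * ((q - r / b) ^ 2 / 8) =
      b ^ (k + 2) * q ^ (k + 4) / (4 * ((k + 2) * (k + 3) * (k + 4))) := by
  have h : ∀ r : ℝ, r ^ (k + 1) * ((q - r / b) ^ 2 / 8) =
      q ^ 2 / 8 * r ^ (k + 1) - q / (4 * b) * r ^ (k + 2) + 1 / (8 * b ^ 2) * r ^ (k + 3) := by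
    intro r
    field_simp
    ring
  simp_rw [h]
  rw [intervalIntegral.integral_add (Continuous.intervalIntegrable (by fun_prop) _ _)
      (Continuous.intervalIntegrable (by fun_prop) _ _),
    intervalIntegral.integral_sub (Continuous.intervalIntegrable (by fun_prop) _ _)
      (Continuous.intervalIntegrable (by fun_prop) _ _),
    intervalIntegral.integral_const_mul, intervalIntegral.integral_const_mul,
    intervalIntegral.integral_const_mul, integral_pow, integral_pow, integral_pow]
  have h1 : (k : ℝ) + 2 ≠ 0 := by positivity
  have h2 : (k : ℝ) + 3 ≠ 0 := by positivity
  have h3 : (k : ℝ) + 4 ≠ 0 := by positivity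
  push_cast
  rw [show (k : ℝ) + 1 + 1 = k + 2 by ring, show (k : ℝ) + 2 + 1 = k + 3 by ring,
    show (k : ℝ) + 3 + 1 = k + 4 by ring]
  simp only [ne_eq, Nat.add_eq_zero_iff, one_ne_zero, and_false, not_false_eq_true, zero_pow,
    sub_zero]
  field_simp
  ring

/-- The lower bound for the transport cost as a function of the coordinate along the axis and the
distance from it. -/
noncomputable def coneCost (p b : ℝ) (z : ℝ × ℝ) : ℝ :=
  if z.1 ^ 2 + z.2 ^ 2 ≤ b * (p * z.1) then
    (p * z.1 / Real.sqrt (z.1 ^ 2 + z.2 ^ 2) - Real.sqrt (z.1 ^ 2 + z.2 ^ 2) / b) ^ 2 / 8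
  else 0

lemma measurable_coneCost (p b : ℝ) : Measurable (coneCost p b) := by
  unfold coneCost
  exact Measurable.ite (measurableSet_le (by fun_prop) (by fun_prop)) (by fun_prop) (by fun_prop)

/-- At angle `φ` from the axis the truncation reads `r ≤ b p cos φ`: it cuts out the ball of
diameter `b p` through the origin, on whose boundary sphere the squared expression vanishes. -/
lemma coneCost_polar {p b r φ : ℝ} (hr : 0 < r) (hle : r ≤ b * (p * Real.cos φ)) :
    coneCost p b (r * Real.cos φ, r * Real.sin φ) = (p * Real.cos φ - r / b) ^ 2 / 8 := by
  have h1 : (r * Real.cos φ) ^ 2 + (r * Real.sin φ) ^ 2 = r ^ 2 := by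
    have := Real.sin_sq_add_cos_sq φ
    linear_combination r ^ 2 * this
  unfold coneCost
  simp only
  rw [h1, Real.sqrt_sq hr.le, if_pos (by nlinarith)]
  congr 3
  field_simp

/-- Restrict to that ball with `0 < φ < π / 2`. The planar Jacobian `r` and the factor `(r sin φ) ^
k` give `r ^ (k + 1) sin ^ k φ`, and `integral_pow_mul_sq` with `q = p cos φ` produces `(p cos φ) ^
(k + 4)`. -/
lemma ofReal_le_lintegral_coneCost (k : ℕ) {p b : ℝ} (hp : 0 < p) (hb : 0 < b) :
    ENNReal.ofReal (sphereArea (k + 1) * (b ^ (k + 2) * p ^ (k + 4) /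
        (4 * ((k + 2) * (k + 3) * (k + 4))) *
          ∫ φ in (0 : ℝ)..(Real.pi / 2), Real.cos φ ^ (k + 4) * Real.sin φ ^ k)) ≤
      ∫⁻ z : WithLp 2 (ℝ × EuclideanSpace ℝ (Fin (k + 1))),
        ENNReal.ofReal (coneCost p b (z.fst, ‖z.snd‖)) := by
  have hpi := Real.pi_pos
  rw [lintegral_prod_fun_norm k (G := fun z => ENNReal.ofReal (coneCost p b z))
    (measurable_coneCost p b).ennreal_ofReal, ENNReal.ofReal_mul (by
      unfold sphereArea; exact measureReal_nonneg)]
  gcongr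
  set C := b ^ (k + 2) * p ^ (k + 4) / (4 * ((k + 2 : ℝ) * (k + 3) * (k + 4))) with hC
  set S : Set (ℝ × ℝ) := {x | x.2 ∈ Ioo 0 (Real.pi / 2) ∧ 0 < x.1 ∧
    x.1 ≤ b * (p * Real.cos x.2)} with hS
  have hSm : MeasurableSet S := by
    exact (measurable_snd measurableSet_Ioo).inter
      ((measurableSet_lt measurable_const measurable_fst).inter
        (measurableSet_le measurable_fst (by fun_prop)))
  have hSsub : S ⊆ polarCoord.target := fun x hx => by
    rw [polarCoord_target]
    exact ⟨hx.2.1, by linarith [hx.1.1], by linarith [hx.1.2]⟩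
  set F : ℝ × ℝ → ℝ := fun x => x.1 ^ (k + 1) * ((p * Real.cos x.2 - x.1 / b) ^ 2 / 8) *
    Real.sin x.2 ^ k with hF
  have hFm : Measurable F := by fun_prop
  calc
    ENNReal.ofReal (C * ∫ φ in (0 : ℝ)..(Real.pi / 2), Real.cos φ ^ (k + 4) * Real.sin φ ^ k)
      = ∫⁻ φ in Ioo 0 (Real.pi / 2), ENNReal.ofReal
          (C * (Real.cos φ ^ (k + 4) * Real.sin φ ^ k)) := by
        rw [← intervalIntegral.integral_const_mul, intervalIntegral.integral_of_le (by positivity),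
          integral_Ioc_eq_integral_Ioo, ofReal_integral_eq_lintegral_ofReal]
        · exact (Continuous.integrableOn_Icc (by fun_prop)).mono_set Ioo_subset_Icc_self
        · filter_upwards [ae_restrict_mem measurableSet_Ioo] with φ hφ
          have h1 := Real.cos_pos_of_mem_Ioo ⟨by linarith [hφ.1], hφ.2⟩
          have h2 := Real.sin_pos_of_pos_of_lt_pi hφ.1 (by linarith [hφ.2])
          simp only [Pi.zero_apply]
          positivity
    _ = ∫⁻ φ in Ioo 0 (Real.pi / 2), ∫⁻ r in Ioc 0 (b * (p * Real.cos φ)),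
          ENNReal.ofReal (F (r, φ)) := by
        refine setLIntegral_congr_fun measurableSet_Ioo fun φ hφ => ?_
        have h1 := Real.cos_pos_of_mem_Ioo ⟨by linarith [hφ.1], hφ.2⟩
        have h2 := Real.sin_pos_of_pos_of_lt_pi hφ.1 (by linarith [hφ.2])
        rw [← ofReal_integral_eq_lintegral_ofReal, ← intervalIntegral.integral_of_le (by positivity)]
        · simp only [hF]
          rw [intervalIntegral.integral_mul_const, integral_pow_mul_sq k hb.ne', hC]
          congr 1
          ring
        · exact (Continuous.integrableOn_Icc (by fun_prop)).mono_set Ioc_subset_Icc_self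
        · filter_upwards [ae_restrict_mem measurableSet_Ioc] with r hr
          have := hr.1
          simp only [Pi.zero_apply, hF]
          positivity
    _ = ∫⁻ φ, ∫⁻ r, S.indicator (fun x => ENNReal.ofReal (F x)) (r, φ) := by
        rw [← lintegral_indicator measurableSet_Ioo]
        refine lintegral_congr fun φ => ?_
        by_cases hφ : φ ∈ Ioo 0 (Real.pi / 2)
        · rw [indicator_of_mem hφ, ← lintegral_indicator measurableSet_Ioc]
          refine lintegral_congr fun r => ?_
          by_cases hr : r ∈ Ioc 0 (b * (p * Real.cos φ))
          · rw [indicator_of_mem hr, indicator_of_mem (show (r, φ) ∈ S from ⟨hφ, hr⟩)]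
          · rw [indicator_of_notMem hr, indicator_of_notMem fun h => hr h.2]
        · rw [indicator_of_notMem hφ]
          have hnot : ∀ r : ℝ, (r, φ) ∉ S := fun r h => hφ h.1
          simp [hnot]
    _ = ∫⁻ x in S, ENNReal.ofReal (F x) := by
        rw [← lintegral_indicator hSm, Measure.volume_eq_prod, lintegral_prod_symm]
        exact (hFm.ennreal_ofReal.indicator hSm).aemeasurable
    _ = ∫⁻ x in S, ENNReal.ofReal x.1 * (Ioi (0 : ℝ)).indicator
          (fun t => ENNReal.ofReal (t ^ k) * ENNReal.ofReal (coneCost p b (x.1 * Real.cos x.2, t)))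
            (x.1 * Real.sin x.2) := by
        refine setLIntegral_congr_fun hSm fun x hx => ?_
        obtain ⟨⟨h0, h1⟩, hr, hle⟩ := hx
        have h2 := Real.sin_pos_of_pos_of_lt_pi h0 (by linarith)
        rw [indicator_of_mem (show x.1 * Real.sin x.2 ∈ Ioi (0 : ℝ) from mul_pos hr h2),
          coneCost_polar hr hle, ← ENNReal.ofReal_mul (by positivity),
          ← ENNReal.ofReal_mul hr.le]
        congr 1
        simp only [hF]
        ring
    _ ≤ _ := lintegral_mono_set hSsub

end RadialIntegral

/-! ### The lower bound for the transport cost -/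

section Estimate

/-- Coordinates on the hyperplane orthogonal to `N` adapted to a direction `e` in it. -/
lemma exists_tangent_coordinates (k : ℕ) {e N : EuclideanSpace ℝ (Fin (k + 3))} (he : ‖e‖ = 1)
    (hN : ‖N‖ = 1) (heN : ⟪e, N⟫ = 0) :
    ∃ P : EuclideanSpace ℝ (Fin (k + 3)) →ₗ[ℝ] WithLp 2 (ℝ × EuclideanSpace ℝ (Fin (k + 1))),
      (∀ X, ‖X‖ ^ 2 = ⟪N, X⟫ ^ 2 + ‖P X‖ ^ 2) ∧ (∀ X, (P X).fst = ⟪e, X⟫) ∧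
        ∀ z, ∃ X, P X = z ∧ ⟪N, X⟫ = 0 := by
  -- In the extended basis index `0` carries `e` and index `1` carries `N`; `P` drops index `1` and
  -- keeps the other `k + 1` indices as its second component.
  have hv : Orthonormal ℝ (({0, 1} : Set (Fin (k + 3))).domRestrict
      fun i => if i = 0 then e else N) := by
    refine ⟨?_, ?_⟩
    · rintro ⟨i, rfl | rfl⟩ <;> simp [he, hN]
    · rintro ⟨i, rfl | rfl⟩ ⟨j, rfl | rfl⟩ hij
      · exact absurd rfl hij
      · simpa using heN
      · simpa [real_inner_comm] using heN
      · exact absurd rfl hij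
  obtain ⟨b, hb⟩ := hv.exists_orthonormalBasis_extension_of_card_eq (by simp)
  have hb0 : b 0 = e := by simpa using hb 0 (by simp)
  have hb1 : b 1 = N := by simpa using hb 1 (by simp)
  let P : EuclideanSpace ℝ (Fin (k + 3)) →ₗ[ℝ] WithLp 2 (ℝ × EuclideanSpace ℝ (Fin (k + 1))) :=
    { toFun := fun X => WithLp.toLp 2 (b.repr X 0, WithLp.toLp 2 fun i => b.repr X i.succ.succ)
      map_add' := fun X Y => WithLp.ofLp_injective 2 (Prod.ext (by simp) (by ext i; simp))
      map_smul' := fun c X => WithLp.ofLp_injective 2 (Prod.ext (by simp) (by ext i; simp)) }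
  have hP : ∀ X, P X = WithLp.toLp 2 (b.repr X 0, WithLp.toLp 2 fun i => b.repr X i.succ.succ) :=
    fun X => rfl
  have hPf : ∀ X, (P X).fst = b.repr X 0 := fun X => rfl
  have hPs : ∀ X i, (P X).snd i = b.repr X i.succ.succ := fun X i => rfl
  have hr1 : ∀ X, b.repr X 1 = ⟪N, X⟫ := fun X => by rw [b.repr_apply_apply, hb1]
  refine ⟨P, fun X => ?_, fun X => ?_, fun z => ?_⟩
  · rw [← hr1, ← b.repr.norm_map X, EuclideanSpace.real_norm_sq_eq, Fin.sum_univ_succ,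
      Fin.sum_univ_succ, WithLp.prod_norm_sq_eq_of_L2, EuclideanSpace.real_norm_sq_eq]
    simp only [Real.norm_eq_abs, sq_abs, hPf, hPs]
    rw [show (Fin.succ 0 : Fin (k + 3)) = 1 from rfl]
    ring
  · rw [hPf, b.repr_apply_apply, hb0]
  · refine ⟨b.repr.symm (WithLp.toLp 2 (Fin.cons z.fst (Fin.cons 0 fun i => z.snd i))), ?_, ?_⟩
    · rw [hP, LinearIsometryEquiv.apply_symm_apply]
      exact WithLp.ofLp_injective 2 (Prod.ext (by simp) (by ext i; simp))
    · rw [← hr1, LinearIsometryEquiv.apply_symm_apply,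
        show (1 : Fin (k + 3)) = Fin.succ 0 from rfl]
      simp

lemma tangentProj_eq {E : Type*} [NormedAddCommGroup E] [InnerProductSpace ℝ E] {Ω : Set E} {X : E}
    (hN : ‖normal Ω X‖ = 1) (V : E) :
    tangentProj Ω X V = V - ⟪normal Ω X, V⟫ • normal Ω X := by
  rw [tangentProj, Submodule.starProjection_orthogonal_val,
    Submodule.starProjection_unit_singleton ℝ hN]

/-- Since `b ≤ 1/4`, replacing `4r` by `r / b` only weakens `cost_ge_of_monotone`; outside the
truncation the cost is merely nonnegative. -/
lemma coneCost_le_cost {E : Type*} [NormedAddCommGroup E] [InnerProductSpace ℝ E]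
    {X₀ Y₀ X Y : E} {p b s t r : ℝ} (hb : 0 < b) (hb4 : b ≤ 1 / 4) (hr0 : 0 ≤ r)
    (hr : r ^ 2 = s ^ 2 + t ^ 2) (hmono : 0 ≤ ⟪X - X₀, Y - Y₀⟫) (hX : ‖X - X₀‖ ≤ 2 * r)
    (hY₀ : p * s ≤ ⟪X - X₀, Y₀ - X₀⟫) : coneCost p b (s, t) ≤ cost X Y := by
  unfold coneCost
  simp only
  rw [← hr, Real.sqrt_sq hr0]
  split_ifs with h
  -- At `r = 0`, division by zero makes `coneCost` vanish.
  · rcases hr0.eq_or_lt with rfl | hrpos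
    · simpa using cost_nonneg X Y
    · set q := p * s / r with hq
      have hqr : q * r = p * s := div_mul_cancel₀ _ hrpos.ne'
      have h1 : r / b ≤ q := by
        rw [div_le_iff₀ hb]
        refine le_of_mul_le_mul_right ?_ hrpos
        rw [mul_right_comm, hqr]
        linarith
      have h2 : 4 * r ≤ r / b := by
        rw [le_div_iff₀ hb]
        nlinarith
      refine le_trans ?_ (cost_ge_of_monotone hrpos (h2.trans h1) hmono hX (hqr ▸ hY₀))
      have := pow_le_pow_left₀ (by linarith : 0 ≤ q - r / b) (by linarith : q - r / b ≤ q - 4 * r) 2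
      linarith
  · exact cost_nonneg X Y

/-- The transport cost is bounded below by the integral of `coneCost` over the tangent hyperplane. -/
theorem lintegral_coneCost_le_W₂_sq (k : ℕ) {Ω : Set (EuclideanSpace ℝ (Fin (k + 3)))}
    (hΩ : IsConvexBody Ω) (hC1 : HasC1Boundary Ω) {R : ℝ} (hR : Ω ⊆ ball 0 R)
    {ρ : EuclideanSpace ℝ (Fin (k + 3)) → ℝ≥0∞}
    {μ ν : Measure (EuclideanSpace ℝ (Fin (k + 3)))} [IsProbabilityMeasure μ]
    [IsProbabilityMeasure ν] (hμ : μ = (surfaceMeasure (n := k + 2) Ω).withDensity ρ)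
    (hν : ν (frontier Ω)ᶜ = 0) {ρ₀ : ℝ}
    (hρ₀ρ : ENNReal.ofReal ρ₀ ≤ essInf ρ (surfaceMeasure (n := k + 2) Ω))
    {u : EuclideanSpace ℝ (Fin (k + 3)) → EReal} (hu : IsDualMaximizer R μ ν u)
    {Θ κ : ℝ} (hΘ : 1 / 2 ≤ Θ) (hκΘ : normalModulus Ω κ < Real.sqrt (2 - 2 * Θ))
    {X₀ Y₀ : EuclideanSpace ℝ (Fin (k + 3))} (hX₀ : X₀ ∈ frontier Ω)
    (hY₀ : Y₀ ∈ cSubdiff Ω u X₀) (hp : 0 < ‖tangentProj Ω X₀ (X₀ - Y₀)‖)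
    {b : ℝ} (hb : 0 < b) (hb4 : b ≤ 1 / 4) (hbκ : b * ‖tangentProj Ω X₀ (X₀ - Y₀)‖ ≤ κ / 2) :
    ENNReal.ofReal ρ₀ * ∫⁻ z : WithLp 2 (ℝ × EuclideanSpace ℝ (Fin (k + 1))),
        ENNReal.ofReal (coneCost ‖tangentProj Ω X₀ (X₀ - Y₀)‖ b (z.fst, ‖z.snd‖)) ≤
      ENNReal.ofReal (W₂ μ ν ^ 2) := by
  have hcl : IsClosed Ω := hΩ.isCompact.isClosed
  have hK : IsCompact (frontier Ω) := hΩ.isCompact.of_isClosed_subset isClosed_frontier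
    hcl.frontier_subset
  have hKm : MeasurableSet (frontier Ω) := isClosed_frontier.measurableSet
  obtain ⟨hN1, hNle⟩ := hΩ.normal_mem hX₀
  set p := ‖tangentProj Ω X₀ (X₀ - Y₀)‖ with hpdef
  set N := normal Ω X₀ with hN
  set t := ⟪N, Y₀ - X₀⟫ with ht
  have ht0 : t ≤ 0 := hNle Y₀ (hcl.frontier_subset hY₀.1)
  have hNN : ⟪N, N⟫ = 1 := by rw [real_inner_self_eq_norm_sq, hN1, one_pow]
  have hpv : p = ‖(Y₀ - X₀) - t • N‖ := by
    rw [hpdef, tangentProj_eq hN1, ← norm_neg, ← neg_sub Y₀ X₀, inner_neg_right]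
    congr 1
    module
  set e := p⁻¹ • ((Y₀ - X₀) - t • N) with he
  have he1 : ‖e‖ = 1 := by
    rw [he, norm_smul, ← hpv, norm_inv, Real.norm_of_nonneg hp.le, inv_mul_cancel₀ hp.ne']
  have heN : ⟪e, N⟫ = 0 := by
    rw [he, real_inner_smul_left, inner_sub_left, real_inner_smul_left, hNN,
      real_inner_comm, ← ht]
    ring
  have hdecomp : Y₀ - X₀ = p • e + t • N := by
    rw [he, smul_smul, mul_inv_cancel₀ hp.ne', one_smul, sub_add_cancel]
  clear_value e
  obtain ⟨P, hPnorm, hPfst, hPsurj⟩ := exists_tangent_coordinates k he1 hN1 heN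
  have hPle : ∀ X, ‖P X‖ ≤ ‖X‖ := fun X =>
    le_of_sq_le_sq (by rw [hPnorm X]; linarith [sq_nonneg ⟪N, X⟫]) (norm_nonneg _)
  have hPN : P N = 0 := by
    have := hPnorm N
    rw [hNN, hN1] at this
    exact norm_eq_zero.mp (pow_eq_zero_iff two_ne_zero |>.mp (by linarith))
  set Q := fun X => P (X - X₀) with hQ
  have hQlip : LipschitzWith 1 Q := LipschitzWith.of_dist_le_mul fun X Y => by
    rw [NNReal.coe_one, one_mul, dist_eq_norm, dist_eq_norm, hQ]
    simp only
    rw [← map_sub, sub_sub_sub_cancel_right]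
    exact hPle _
  have hQm : Measurable Q := hQlip.continuous.measurable
  set G : WithLp 2 (ℝ × EuclideanSpace ℝ (Fin (k + 1))) → ℝ≥0∞ :=
    fun z => ENNReal.ofReal (coneCost p b (z.fst, ‖z.snd‖)) with hG
  have hpair : Continuous fun z : WithLp 2 (ℝ × EuclideanSpace ℝ (Fin (k + 1))) =>
      (z.fst, ‖z.snd‖) := by fun_prop
  have hGm : Measurable G :=
    ((measurable_coneCost p b).comp hpair.measurable).ennreal_ofReal
  set S := {X | ‖X - X₀‖ ≤ 2 * ‖Q X‖} with hS
  have hSm : MeasurableSet S :=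
    (isClosed_le (by fun_prop) (continuous_const.mul hQlip.continuous.norm)).measurableSet
  set B := {z : WithLp 2 (ℝ × EuclideanSpace ℝ (Fin (k + 1))) | 2 * ‖z‖ ≤ κ} with hB
  have hBm : MeasurableSet B := (isClosed_le (by fun_prop) continuous_const).measurableSet
  have hBsub : B ⊆ Q '' (S ∩ frontier Ω) := by
    intro z hz
    obtain ⟨x, hxz, hx⟩ := hPsurj z
    have hnorm : ‖x‖ = ‖z‖ := by
      have := hPnorm x
      rw [hx, hxz] at this
      exact (pow_left_inj₀ (norm_nonneg _) (norm_nonneg _) two_ne_zero).mp (by linarith)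
    obtain ⟨h, hmem, hle⟩ := exists_frontier_above_tangent hΩ hC1 hΘ hκΘ hX₀ hx
      (by rw [hnorm]; exact hz)
    have hsub : X₀ + x - h • N - X₀ = x - h • N := by abel
    have hQX : Q (X₀ + x - h • N) = z := by
      rw [hQ]
      simp only
      rw [hsub, map_sub, map_smul, hPN, smul_zero, sub_zero, hxz]
    refine ⟨X₀ + x - h • N, ⟨?_, hmem⟩, hQX⟩
    simp only [hS, mem_ofPred_eq]
    rw [hQX, hsub, ← hnorm]
    exact hle
  -- On the truncated region `‖z‖² ≤ b p ‖z‖`, so `‖z‖ ≤ b p ≤ κ / 2`: the model cost lives on the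
  -- disc covered by the boundary.
  have hGsupp : ∀ z, z ∉ B → G z = 0 := by
    intro z hz
    simp only [hG, coneCost]
    rw [if_neg, ENNReal.ofReal_zero]
    intro hle
    refine hz ?_
    have h1 : ‖z‖ ^ 2 = z.fst ^ 2 + ‖z.snd‖ ^ 2 := by
      rw [WithLp.prod_norm_sq_eq_of_L2, Real.norm_eq_abs, sq_abs]
    rw [← h1] at hle
    have h2 : z.fst ≤ ‖z‖ := abs_le_of_sq_le_sq' (by rw [h1]; nlinarith) (norm_nonneg _) |>.2
    rcases (norm_nonneg z).eq_or_lt with h0 | h0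
    · simp only [hB, mem_ofPred_eq]
      nlinarith [mul_pos hb hp]
    · have : ‖z‖ * ‖z‖ ≤ b * p * ‖z‖ := by
        have := mul_le_mul_of_nonneg_left h2 (mul_pos hb hp).le
        nlinarith
      have := le_of_mul_le_mul_right this h0
      simp only [hB, mem_ofPred_eq]
      linarith
  have hμK : ∀ᵐ X ∂μ, X ∈ frontier Ω := by
    rw [hμ]
    exact (withDensity_absolutelyContinuous _ _).ae_le (ae_restrict_mem hKm)
  obtain ⟨γ, f, hγ1, huf, hγc, hγW⟩ := exists_optimal_coupling hK
    (hcl.frontier_subset.trans hR) hμK (mem_ae_iff.mpr hν) hu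
  have hcontact : ∀ Y ∈ frontier Ω, -cost Y Y₀ + cost X₀ Y₀ + f X₀ ≤ f Y := fun Y hY => by
    have := hY₀.2 Y hY
    rw [huf X₀ hX₀, huf Y hY] at this
    exact_mod_cast this
  have hμge : ENNReal.ofReal ρ₀ • surfaceMeasure (n := k + 2) Ω ≤ μ := by
    rw [hμ, ← withDensity_const]
    exact withDensity_mono ((ae_essInf_le (f := ρ)).mono fun X hX => hρ₀ρ.trans hX)
  have hHm : Measurable (S.indicator (G ∘ Q)) := (hGm.comp hQm).indicator hSm
  calc
    ENNReal.ofReal ρ₀ * ∫⁻ z, G z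
      = ENNReal.ofReal ρ₀ * ∫⁻ z in B, G z := by
        rw [← lintegral_indicator hBm]
        congr 2
        ext z
        by_cases hz : z ∈ B
        · rw [indicator_of_mem hz]
        · rw [indicator_of_notMem hz, hGsupp z hz]
    _ ≤ ENNReal.ofReal ρ₀ * ∫⁻ z, G z ∂(((Measure.euclideanHausdorffMeasure (k + 2) :
          Measure (EuclideanSpace ℝ (Fin (k + 3)))).restrict (S ∩ frontier Ω)).map Q) := by
        gcongr
        refine volume_restrict_le_map_euclideanHausdorffMeasure ?_ hQlip hBsub
        rw [LinearEquiv.finrank_eq (WithLp.linearEquiv 2 ℝ (ℝ × EuclideanSpace ℝ (Fin (k + 1)))),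
          Module.finrank_prod, Module.finrank_self, finrank_euclideanSpace_fin]
        omega
    _ = ∫⁻ X, S.indicator (G ∘ Q) X
          ∂(ENNReal.ofReal ρ₀ • surfaceMeasure (n := k + 2) Ω) := by
        rw [lintegral_map hGm hQm, lintegral_smul_measure, lintegral_indicator hSm,
          surfaceMeasure, Measure.restrict_restrict hSm, smul_eq_mul]
        rfl
    _ ≤ ∫⁻ X, S.indicator (G ∘ Q) X ∂μ := lintegral_mono' hμge le_rfl
    _ = ∫⁻ q, S.indicator (G ∘ Q) q.1 ∂γ := by
        rw [← hγ1, lintegral_map hHm measurable_fst]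
    _ ≤ ∫⁻ q, ENNReal.ofReal (cost q.1 q.2) ∂γ := by
        refine lintegral_mono_ae ?_
        filter_upwards [hγc] with q hq
        obtain ⟨hq1, hq2⟩ := hq
        by_cases hqS : q.1 ∈ S
        · rw [indicator_of_mem hqS]
          refine ENNReal.ofReal_le_ofReal
            (coneCost_le_cost (X₀ := X₀) (Y₀ := Y₀) (r := ‖Q q.1‖) hb hb4 (norm_nonneg _) ?_ ?_ hqS
              ?_)
          · rw [WithLp.prod_norm_sq_eq_of_L2, Real.norm_eq_abs, sq_abs]
          -- Add the contact inequality of `(q.1, q.2)` tested at `X₀` to that of `(X₀, Y₀)` tested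
          -- at `q.1`; the potentials cancel.
          · rw [← cost_add_cost_sub]
            linarith [hq2 X₀ hX₀, hcontact q.1 hq1]
          · rw [hdecomp, inner_add_right, real_inner_smul_right, real_inner_smul_right,
              real_inner_comm N (q.1 - X₀), real_inner_comm e (q.1 - X₀), hQ, hPfst]
            -- The normal contribution is a product of two nonpositive numbers, by convexity.
            have := mul_nonneg_of_nonpos_of_nonpos ht0 (hNle q.1 (hcl.frontier_subset hq1))
            linarith
        · rw [indicator_of_notMem hqS]
          exact zero_le
    _ ≤ ENNReal.ofReal (W₂ μ ν ^ 2) := hγW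

/-- With `n = k + 2` this is `n + 2 ≤ 2 ^ n`; it absorbs the factor `n + 2` of the radial integral,
which the final constant does not show. -/
lemma add_four_le_two_pow (k : ℕ) : k + 4 ≤ 2 ^ (k + 2) := by
  induction k with
  | zero => norm_num
  | succ k ih => rw [show k + 1 + 2 = (k + 2) + 1 by ring, pow_succ]; omega

lemma integral_cos_pow_mul_sin_pow_pos (i j : ℕ) :
    0 < ∫ φ in (0 : ℝ)..(Real.pi / 2), Real.cos φ ^ i * Real.sin φ ^ j := by
  have hpi := Real.pi_pos
  refine intervalIntegral.intervalIntegral_pos_of_pos_on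
    (Continuous.intervalIntegrable (by fun_prop) _ _) (fun φ hφ => ?_) (by positivity)
  have h1 := Real.cos_pos_of_mem_Ioo ⟨by linarith [hφ.1], hφ.2⟩
  have h2 := Real.sin_pos_of_pos_of_lt_pi hφ.1 (by linarith [hφ.2])
  positivity

lemma sphereArea_succ_pos (k : ℕ) : 0 < sphereArea (k + 1) := by
  unfold sphereArea
  rw [measureReal_def, ENNReal.toReal_pos_iff]
  exact ⟨Measure.measure_univ_pos.mpr (Measure.toSphere_ne_zero _), measure_lt_top _ _⟩

lemma le_rpow_mul_rpow_of_mul_pow_le {K p W : ℝ} (hK : 0 < K) (hp : 0 ≤ p) (hW : 0 ≤ W) (n : ℕ)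
    (h : K * p ^ (n + 2) ≤ W ^ 2) :
    p ≤ K ^ (-(1 / ((n : ℝ) + 2))) * W ^ (2 / ((n : ℝ) + 2)) := by
  have hn : (0 : ℝ) < (n : ℝ) + 2 := by positivity
  have h1 : p ^ (n + 2) ≤ K⁻¹ * W ^ 2 := by
    rw [inv_mul_eq_div, le_div_iff₀' hK]
    exact h
  have h2 := Real.rpow_le_rpow (by positivity) h1 (by positivity : 0 ≤ 1 / ((n : ℝ) + 2))
  rw [Real.mul_rpow (by positivity) (by positivity), ← Real.rpow_natCast p,
    ← Real.rpow_natCast W, ← Real.rpow_mul hp, ← Real.rpow_mul hW, Real.inv_rpow hK.le,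
    ← Real.rpow_neg hK.le] at h2
  push_cast at h2
  rwa [mul_one_div_cancel hn.ne', Real.rpow_one, mul_one_div] at h2

end Estimate

end StayAway

/-! ### The stay-away estimate -/

theorem proposition5p1 (n : ℕ) (hn : 2 ≤ n)
    (Ω : Set (EuclideanSpace ℝ (Fin (n + 1))))
    (hΩ : StayAway.IsConvexBody Ω) (hC1 : StayAway.HasC1Boundary Ω)
    (R : ℝ) (hR : Ω ⊆ Metric.ball 0 R)
    (ρ : EuclideanSpace ℝ (Fin (n + 1)) → ENNReal)
    (hρ : AEMeasurable ρ (StayAway.surfaceMeasure Ω))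
    (μ ν : MeasureTheory.Measure (EuclideanSpace ℝ (Fin (n + 1))))
    [MeasureTheory.IsProbabilityMeasure μ] [MeasureTheory.IsProbabilityMeasure ν]
    (hμ : μ = (StayAway.surfaceMeasure Ω).withDensity ρ)
    (hν : ν (frontier Ω)ᶜ = 0)
    (ρ₀ : ℝ) (hρ₀ : 0 < ρ₀)
    (hρ₀ρ : ENNReal.ofReal ρ₀ ≤ essInf ρ (StayAway.surfaceMeasure Ω))
    (u : EuclideanSpace ℝ (Fin (n + 1)) → EReal)
    (hu : StayAway.IsDualMaximizer R μ ν u)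
    (Θ : ℝ) (hΘ : Θ ∈ Set.Ico (1 / 2 : ℝ) 1)
    (κ : ℝ) (hκ : 0 < κ)
    (hκΘ : StayAway.normalModulus Ω κ < Real.sqrt (2 - 2 * Θ))
    (X₀ : EuclideanSpace ℝ (Fin (n + 1))) (hX₀ : X₀ ∈ frontier Ω)
    (Xb₀ : EuclideanSpace ℝ (Fin (n + 1)))
    (hXb₀ : Xb₀ ∈ StayAway.cSubdiff Ω u X₀ ∩ StayAway.sameSide Ω X₀) :
    ‖StayAway.tangentProj Ω X₀ (X₀ - Xb₀)‖ ≤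
      StayAway.stayAwayConst n ρ₀ κ (Metric.diam Ω)
        * StayAway.W₂ μ ν ^ (2 / ((n : ℝ) + 2)) := by
  obtain ⟨k, rfl⟩ : ∃ k, n = k + 2 := ⟨n - 2, by omega⟩
  set p := ‖StayAway.tangentProj Ω X₀ (X₀ - Xb₀)‖ with hp
  set D := Metric.diam Ω with hD
  have hcl : IsClosed Ω := hΩ.isCompact.isClosed
  have hA := StayAway.sphereArea_succ_pos k
  have hI := StayAway.integral_cos_pow_mul_sin_pow_pos (k + 4) k
  have hW : 0 ≤ StayAway.W₂ μ ν := Real.sqrt_nonneg _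
  -- Zero displacement is trivial; otherwise `0 < p ≤ D`, which makes the divisions by `D`
  -- legitimate.
  rcases (norm_nonneg (StayAway.tangentProj Ω X₀ (X₀ - Xb₀))).eq_or_lt with h0 | hpos
  · rw [hp, ← h0]
    refine mul_nonneg ?_ (Real.rpow_nonneg hW _)
    unfold StayAway.stayAwayConst
    refine Real.rpow_nonneg ?_ _
    simp only [Nat.add_sub_cancel, show k + 2 - 1 = k + 1 from rfl,
      show k + 2 + 2 = k + 4 from rfl]
    have hDn : 0 ≤ D := Metric.diam_nonneg
    positivity
  rw [← hp] at hpos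
  have hpD : p ≤ D := by
    rw [hp]
    refine (Submodule.norm_starProjection_apply_le _ _).trans ?_
    rw [← dist_eq_norm]
    exact Metric.dist_le_diam_of_mem hΩ.isCompact.isBounded (hcl.frontier_subset hX₀)
      (hcl.frontier_subset hXb₀.1.1)
  have hDpos : 0 < D := hpos.trans_le hpD
  set a := min (κ ^ 2 / (48 * D ^ 2 + 2 * κ ^ 2)) (min (κ / (8 * D)) (1 / 16)) with ha
  have hapos : 0 < a := lt_min (by positivity) (lt_min (by positivity) (by norm_num))
  have ha1 : a ≤ κ / (8 * D) := (min_le_right _ _).trans (min_le_left _ _)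
  have ha2 : a ≤ 1 / 16 := (min_le_right _ _).trans (min_le_right _ _)
  have hbκ : 4 * a * p ≤ κ / 2 := by
    have h1 : a * (8 * D) ≤ κ := (le_div_iff₀ (by positivity)).mp ha1
    have h2 : a * p ≤ a * D := mul_le_mul_of_nonneg_left hpD hapos.le
    linarith
  -- The choice is `b = 4a`: the entry `1/16` of the minimum gives `b ≤ 1/4`, and `κ / (8D)` gives
  -- `b p ≤ κ / 2`.
  have key := StayAway.lintegral_coneCost_le_W₂_sq k hΩ hC1 hR hμ hν hρ₀ρ hu hΘ.1 hκΘ hX₀ hXb₀.1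
    hpos (by positivity : 0 < 4 * a) (by linarith) hbκ
  have key2 := (mul_le_mul_right (StayAway.ofReal_le_lintegral_coneCost k hpos
    (by positivity : 0 < 4 * a)) (ENNReal.ofReal ρ₀)).trans key
  rw [← ENNReal.ofReal_mul hρ₀.le, ENNReal.ofReal_le_ofReal_iff (by positivity)] at key2
  unfold StayAway.stayAwayConst
  refine StayAway.le_rpow_mul_rpow_of_mul_pow_le ?_ hpos.le hW (k + 2) (le_trans ?_ key2)
  · simp only [Nat.add_sub_cancel, show k + 2 - 1 = k + 1 from rfl,
      show k + 2 + 2 = k + 4 from rfl]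
    rw [← ha]
    positivity
  · simp only [Nat.add_sub_cancel, show k + 2 - 1 = k + 1 from rfl,
      show k + 2 + 2 = k + 4 from rfl]
    rw [← ha]
    set I := ∫ φ in (0 : ℝ)..(Real.pi / 2), Real.cos φ ^ (k + 4) * Real.sin φ ^ k with hIdef
    set A := StayAway.sphereArea (k + 1) with hAdef
    have hpow : ((k : ℝ) + 4) ≤ 2 ^ (k + 2) := by exact_mod_cast StayAway.add_four_le_two_pow k
    have hk : (0 : ℝ) < (k + 2) * (k + 3) := by positivity
    have hk4 : (0 : ℝ) < (k : ℝ) + 4 := by positivity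
    have h2k : (2 : ℝ) ^ k / ((k + 2) * (k + 3)) ≤
        4 ^ (k + 2) / (4 * ((k + 2) * (k + 3) * (k + 4))) := by
      rw [div_le_div_iff₀ hk (by positivity)]
      have h4 : (4 : ℝ) ^ (k + 2) = 2 ^ (k + 2) * (4 * 2 ^ k) := by
        rw [show (4 : ℝ) = 2 * 2 by norm_num, mul_pow, pow_add 2 k 2]
        ring
      rw [h4]
      have := mul_le_mul_of_nonneg_left hpow
        (by positivity : (0 : ℝ) ≤ 2 ^ k * 4 * ((k + 2) * (k + 3)))
      linarith
    have h := mul_le_mul_of_nonneg_right h2k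
      (by positivity : (0 : ℝ) ≤ ρ₀ * A * a ^ (k + 2) * I * p ^ (k + 4))
    refine (le_of_eq ?_).trans (h.trans (le_of_eq ?_))
    · push_cast
      rw [show (k : ℝ) + 2 + 1 = k + 3 by ring]
      ring
    · rw [mul_pow]
      ring
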